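/- **Model.** $n\ge 1$ nodes all start in slot $1$ of a single synchronous channel. In each slot every active node either broadcasts or is idle. If exactly one active node broadcasts and the slot is not jammed, that node succeeds and leaves the system; a node is active until it has succeeded. After each slot the nodes learn only whether the slot contained a success (no collision detection). Nodes have private randomness and know neither $n$ nor $d$. An adaptive (possibly randomized) adversary with budget $d\ge 1$ decides at the beginning of each slot, from the whole past behaviour of all nodes but without knowing their choices in the current slot, whether to jam it; it jams at most $d$ slots. A slot is active if at least one node is active in it. **Two-phase algorithm with parameter $c>0$.** Odd slots form the data channel and even slots the control channel; the $k$-th round consists of slots $2k-1$ and $2k$. *Phase one.* Initialize $\ell\gets 1$, $t\gets 1$, $m\gets\infty$. In each round, broadcast with probability $\min\{1/\ell,1\}$ in the data slot and with probability $\min\{(c\log\ell)/\ell,1\}$ in the control slot. If the control slot contains a success, let $\ell\gets\max\{\ell/2,1\}$ and then $m\gets\min\{m,\ell\}$; otherwise let $\ell\gets\ell+1$. Then let $t\gets t+1$; if now $m\le t/\log t$, go to phase two. *Phase two.* In the $x$-th round of this phase ($x=1,2,\dots$) do not broadcast in the data slot, and broadcast in the control slot with probability $\min\{(c\log x)/x,1\}$.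 **Theorem 1.2 (Static Case Upper Bound).** For every $\beta\ge 1$ there are constants $c>0$ and $C$, depending only on $\beta$, such that for all integers $n,d\ge 1$ and every adaptive adversary with jamming budget $d$, the two-phase algorithm with parameter $c$, run by $n$ nodes that all start simultaneously, satisfies: - with probability at least $1-(n+d)^{-\beta}$ the total number of active slots is at most $C\,(n+d)$ (in particular all $n$ nodes succeed within $C\,(n+d)$ slots); - with probability at least $1-(n+d)^{-\beta}$ every node broadcasts in at most $C\,\bigl(\log^2(n+1)+\log^2(d+1)\bigr)$ slots. -/

import Mathlib

open MeasureTheory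
open scoped unitInterval

noncomputable section

namespace ContentionResolution

/-! ### Slots and histories -/

/-- What happens in one slot of a single-channel system with `n` nodes: the set of nodes that
broadcast, and whether the slot is jammed. -/
structure Slot (n : ℕ) where
  /-- the nodes that broadcast in this slot -/
  senders : Finset (Fin n)
  /-- whether the adversary jams this slot -/
  jammed : Bool

/-- Node `i` succeeds in the slot: the slot is not jammed and `i` broadcasts alone. -/
def Slot.SucceedsFor {n : ℕ} (s : Slot n) (i : Fin n) : Prop :=
  s.jammed = false ∧ s.senders = {i}

/-- The slot contains a success. -/
def Slot.HasSuccess {n : ℕ} (s : Slot n) : Prop :=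
  ∃ i, s.SucceedsFor i

/-- The past of an execution, the most recent slot first. -/
abbrev History (n : ℕ) := List (Slot n)

/-- All nodes start in the first slot. A node is active as long as it has not succeeded;
after its success it has left the system. -/
def IsActive {n : ℕ} (h : History n) (i : Fin n) : Prop :=
  ∀ s ∈ h, ¬ s.SucceedsFor i

/-- The number of jammed slots in a history. -/
def jamCount {n : ℕ} (h : History n) : ℕ :=
  h.countP (fun s => s.jammed)

/-! ### Algorithms and adversaries -/

/-- What a node has observed since its activation, the most recent slot first: for each slot,
whether the node itself broadcast, and the binary channel feedback, that is, whether
the slot contained a success. (No collision detection: silence, collisions and jamming all give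
the feedback `false`.) -/
abbrev View := List (Bool × Bool)

open Classical in
/-- The view of node `i`. -/
def view {n : ℕ} (h : History n) (i : Fin n) : View :=
  h.map fun s => (decide (i ∈ s.senders), decide s.HasSuccess)

/-- A randomized algorithm, executed by each node separately and with private randomness: it maps
the view of the node to the probability with which the node broadcasts in the next slot. It knows
neither the number of nodes, nor the jamming budget, nor an identity of the node. -/
structure Algorithm where
  /-- the broadcasting probability in the next slot -/
  sendProb : View → I

/-- An adaptive (possibly randomized) adversary against `n` nodes with jamming budget `d`.
At the beginning of each slot it knows the past behaviour of all nodes, and it jams the slot with a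
probability that depends on this past, independently of what the nodes do in the current slot.
It never jams more than `d` slots. -/
structure Adversary (n d : ℕ) where
  /-- the probability of jamming the next slot -/
  jamProb : History n → I
  /-- once `d` slots have been jammed, no further slot is jammed -/
  budget : ∀ h, d ≤ jamCount h → jamProb h = 0

/-! ### Executions -/

/-- The randomness of an execution: one number in `[0,1]` for each slot for the adversary, and
one number in `[0,1]` for each slot and each node. -/
abbrev Coins (n : ℕ) := (ℕ → I) × (ℕ → Fin n → I)

/-- All the coins are independent and uniformly distributed on `[0,1]`. -/
def coinMeasure (n : ℕ) : Measure (Coins n) :=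
  (Measure.infinitePi fun _ : ℕ => (volume : Measure I)).prod
    (Measure.infinitePi fun _ : ℕ => Measure.pi fun _ : Fin n => (volume : Measure I))

open Classical in
/-- The slot that follows the history `h` when the adversary's coin shows `v` and the nodes' coins
show `u`: a coin that shows less than `p` is an event of probability `p`. -/
def nextSlot {n d : ℕ} (A : Algorithm) (E : Adversary n d) (h : History n) (v : I)
    (u : Fin n → I) : Slot n where
  senders := Finset.univ.filter fun i => IsActive h i ∧ u i < A.sendProb (view h i)
  jammed := decide (v < E.jamProb h)

/-- The history of the first `t` slots. -/
def history {n d : ℕ} (A : Algorithm) (E : Adversary n d) (ω : Coins n) : ℕ → History n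
  | 0 => []
  | t + 1 => nextSlot A E (history A E ω t) (ω.1 t) (ω.2 t) :: history A E ω t

/-- The slot that comes after the first `t` slots. -/
def slotAt {n d : ℕ} (A : Algorithm) (E : Adversary n d) (ω : Coins n) (t : ℕ) : Slot n :=
  nextSlot A E (history A E ω t) (ω.1 t) (ω.2 t)

/-- The active slots: those in which at least one node is active. -/
def activeSlots {n d : ℕ} (A : Algorithm) (E : Adversary n d) (ω : Coins n) : Set ℕ :=
  {t | ∃ i, IsActive (history A E ω t) i}

/-- The slots in which node `i` broadcasts. -/
def attempts {n d : ℕ} (A : Algorithm) (E : Adversary n d) (ω : Coins n) (i : Fin n) : Set ℕ :=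
  {t | i ∈ (slotAt A E ω t).senders}

/-! ### Time cost and energy cost -/

/-- `A` achieves `(f, g)`-time-cost when all nodes start simultaneously, where "with high
probability in `n + d`" means with probability at least `1 - 1 / (n + d) ^ β`. -/
def AchievesTimeCost (A : Algorithm) (β : ℝ) (f g : ℕ → ℝ) : Prop :=
  ∃ C : ℝ, ∀ n d : ℕ, 1 ≤ n → 1 ≤ d → ∀ E : Adversary n d,
    1 - 1 / ((n : ℝ) + (d : ℝ)) ^ β ≤
      (coinMeasure n).real
        {ω | ((activeSlots A E ω).encard : ENNReal) ≤ ENNReal.ofReal (C * (f n + g d))}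

/-- `A` achieves `(f, g)`-energy-cost when all nodes start simultaneously, where "with high
probability in `n + d`" means with probability at least `1 - 1 / (n + d) ^ β`. -/
def AchievesEnergyCost (A : Algorithm) (β : ℝ) (f g : ℕ → ℝ) : Prop :=
  ∃ C : ℝ, ∀ n d : ℕ, 1 ≤ n → 1 ≤ d → ∀ E : Adversary n d,
    1 - 1 / ((n : ℝ) + (d : ℝ)) ^ β ≤
      (coinMeasure n).real
        {ω | ∀ i, ((attempts A E ω i).encard : ENNReal) ≤ ENNReal.ofReal (C * (f n + g d))}

/-! ### The two-phase algorithm -/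

/-- The internal state of a node. -/
inductive State where
  /-- phase one, with the variables `l`, `t` and `m` -/
  | one (l : ℝ) (t : ℕ) (m : WithTop ℝ)
  /-- phase two, before the `x`-th step of the backoff -/
  | two (x : ℕ)

/-- Initially `l = 1`, `t = 1` and `m = ∞`. -/
def State.init : State := .one 1 1 ⊤

/-- Broadcasting probability on the data channel: `1 / l` in phase one; silence in phase two. -/
def State.dataProb : State → ℝ
  | .one l _ _ => min (1 / l) 1
  | .two _ => 0

/-- Broadcasting probability on the control channel: `(c log l) / l` in phase one,
`(c log x) / x` in phase two (truncated at `1`). -/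
def State.controlProb (c : ℝ) : State → ℝ
  | .one l _ _ => min (c * Real.log l / l) 1
  | .two x => min (c * Real.log x / x) 1

/-- Update after the control slot; `success` tells whether it contained a success. In phase one,
a success halves `l` (but not below `1`) and records the new value in `m`, and otherwise
`l` grows by one; then `t` grows by one, and phase two starts when `m ≤ t / log t`. -/
def State.update (success : Bool) : State → State
  | .one l t m =>
    let l' : ℝ := if success then max (l / 2) 1 else l + 1
    let m' : WithTop ℝ := if success then min m (l' : WithTop ℝ) else m
    let t' : ℕ := t + 1
    if m' ≤ (((t' : ℝ) / Real.log t' : ℝ) : WithTop ℝ) then .two 1 else .one l' t' m'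
  | .two x => .two (x + 1)

/-- The state of a node after a view. The slots are paired: the odd slots (first, third, ...) form
the data channel and the even slots form the control channel. The state changes at the end of each
control slot, that is, when a slot is preceded by an odd number of slots. -/
def stateOf : View → State
  | [] => State.init
  | (_, success) :: w => if Odd w.length then (stateOf w).update success else stateOf w

/-- The two-phase algorithm with parameter `c`; `Set.projIcc 0 1` only reads a real
number in `[0,1]` as an element of the type `[0,1]`. -/
def twoPhaseAlgorithm (c : ℝ) : Algorithm where
  sendProb w := Set.projIcc 0 1 zero_le_one
    (if Even w.length then (stateOf w).dataProb else (stateOf w).controlProb c)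

end ContentionResolution

end

noncomputable section

namespace ContentionResolution

/-! ### One-step integration along an execution -/

/-! Feedback is common to all nodes, so the active ones share a single state `gstate` and one
broadcasting probability `p`. With `N` active nodes an unjammed slot then succeeds with probability
`N * p * (1 - p) ^ (N - 1)`. The adversary enters only through the number of jams, at most `d`.
Since each coin can be integrated out given the past, an adaptive execution is handled by
exponential supermartingales (`measure_le_of_supermartingale`) and a union bound over slots
(`measure_not_le_of_step`).

Time. Let `M` bound `n` and `d` and be large. There are three ways in which a node can still be
active after `O(M)` slots, each of probability at most `M ^ (-γ)`.

(a) A control success occurs although `N > max l √M`. Then `N * p` is at least of order `c * log N`,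
so collisions make this polynomially unlikely (`measure_not_controlled_le`). Otherwise every
recorded `m` satisfies `N ≤ max (2 * m) √M`, hence phase two starts with only `O(M / log M)` active
nodes.

(b) Phase one lasts `K * M` rounds. A round normally increases time plus `l` by at most `2`. If `l`
is less than a constant times `N`, the data slot succeeds with constant probability and removes a
node. If `l` is larger, the control slot succeeds with probability of order `log l / l` and removes
`l / 2` from `l`. A jam is paid for from the budget. So time plus `l` plus `b * N` minus twice the
jams has an exponential moment that does not grow, while time alone would force it up
(`measure_inPhaseOne_le`).

(c) A node survives phase two. When `x` is of order `M`, the expected number of broadcasters per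
control slot is at most `1`, so a given node succeeds in each unjammed one with probability of order
`log M / M`, and a linear number of these slots is unjammed (`measure_waitsInPhaseTwo_le`).

Energy. The sum of `1 / l` and `1 / x` over all slots is `O(log)` on every execution, successful or
not: while `m = ∞` one has `l = t`, a harmonic sum; afterwards `l ≥ m > t / log t` until the phase
ends; phase two is harmonic again (`totalRate_le`). Probabilities exceed these rates by at most a
factor `O(log)`, and a Chernoff-type supermartingale turns the resulting `O(log²)` mean into a bound
with high probability (`measure_attemptCount_le`). -/

theorem map_update_infinitePi {ι : Type*} [DecidableEq ι] {X : ι → Type*}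
    [∀ i, MeasurableSpace (X i)] (μ : ∀ i, Measure (X i)) [∀ i, IsProbabilityMeasure (μ i)]
    (i : ι) :
    ((Measure.infinitePi μ).prod (μ i)).map (fun z => Function.update z.1 i z.2) =
      Measure.infinitePi μ := by
  have hm : Measurable fun z : (∀ i, X i) × X i => Function.update z.1 i z.2 := by
    rw [measurable_pi_iff]
    intro j
    by_cases hj : j = i
    · subst hj
      simpa using measurable_snd
    · simp only [Function.update_of_ne hj]
      exact (measurable_pi_apply j).comp measurable_fst
  refine Measure.eq_infinitePi μ fun s t ht => ?_
  rw [Measure.map_apply hm (MeasurableSet.pi s.countable_toSet fun j _ => ht j)]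
  by_cases hi : i ∈ s
  · have hpre : (fun z : (∀ i, X i) × X i => Function.update z.1 i z.2) ⁻¹' (Set.pi s t) =
        (Set.pi (s.erase i : Finset ι) t) ×ˢ t i := by
      ext ⟨f, x⟩
      simp only [Set.mem_preimage, Set.mem_pi, Finset.mem_coe, Set.mem_prod, Finset.mem_erase]
      constructor
      · intro h
        refine ⟨fun j hj => ?_, ?_⟩
        · simpa [Function.update_of_ne hj.1] using h j hj.2
        · simpa using h i hi
      · rintro ⟨h1, h2⟩ j hj
        by_cases hji : j = i
        · subst hji
          simpa using h2
        · simpa [Function.update_of_ne hji] using h1 j ⟨hji, hj⟩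
    rw [hpre, Measure.prod_prod, Measure.infinitePi_pi μ fun j _ => ht j, mul_comm,
      Finset.mul_prod_erase s (fun j => μ j (t j)) hi]
  · have hpre : (fun z : (∀ i, X i) × X i => Function.update z.1 i z.2) ⁻¹' (Set.pi s t) =
        (Set.pi s t) ×ˢ Set.univ := by
      ext ⟨f, x⟩
      simp only [Set.mem_preimage, Set.mem_pi, Finset.mem_coe, Set.mem_prod, Set.mem_univ, and_true]
      refine forall₂_congr fun j hj => ?_
      rw [Function.update_of_ne (by rintro rfl; exact hi hj)]
    rw [hpre, Measure.prod_prod, Measure.infinitePi_pi μ fun j _ => ht j, measure_univ, mul_one]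

/-- Resampling one coordinate preserves a product measure. This stands in for conditioning on the
past: the coin of slot `t` is integrated first, the others being fixed. -/
theorem lintegral_update_infinitePi {ι : Type*} [DecidableEq ι] {X : ι → Type*}
    [∀ i, MeasurableSpace (X i)] (μ : ∀ i, Measure (X i)) [∀ i, IsProbabilityMeasure (μ i)]
    (i : ι) {f : (∀ i, X i) → ENNReal} (hf : Measurable f) :
    ∫⁻ x, f x ∂(Measure.infinitePi μ) =
      ∫⁻ x, ∫⁻ y, f (Function.update x i y) ∂(μ i) ∂(Measure.infinitePi μ) := by
  have hm : Measurable fun z : (∀ i, X i) × X i => Function.update z.1 i z.2 := by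
    rw [measurable_pi_iff]
    intro j
    by_cases hj : j = i
    · subst hj
      simpa using measurable_snd
    · simp only [Function.update_of_ne hj]
      exact (measurable_pi_apply j).comp measurable_fst
  conv_lhs => rw [← map_update_infinitePi μ i]
  rw [lintegral_map hf hm, lintegral_prod (fun z => f (Function.update z.1 i z.2)) (hf.comp hm).aemeasurable]

/-- Slots are finite in number and histories countable, so with discrete σ-algebras every adversary,
potential and event that depends on the history is measurable. -/
instance (n : ℕ) : MeasurableSpace (Slot n) := ⊤
instance (n : ℕ) : DiscreteMeasurableSpace (Slot n) := ⟨fun _ => trivial⟩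
instance (n : ℕ) : MeasurableSpace (History n) := ⊤
instance (n : ℕ) : DiscreteMeasurableSpace (History n) := ⟨fun _ => trivial⟩

instance (n : ℕ) : Finite (Slot n) :=
  Finite.of_injective (fun s : Slot n => (s.senders, s.jammed)) fun s s' h => by
    cases s; cases s'; simpa using h

instance (n : ℕ) : Countable (History n) := inferInstanceAs (Countable (List (Slot n)))

instance (n : ℕ) : IsProbabilityMeasure (coinMeasure n) := by
  unfold coinMeasure; infer_instance

variable {n d : ℕ} {A : Algorithm} {E : Adversary n d}

theorem measurable_nextSlot (A : Algorithm) (E : Adversary n d) (h : History n) :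
    Measurable fun x : I × (Fin n → I) => nextSlot A E h x.1 x.2 := by
  classical
  refine measurable_to_countable' fun s => ?_
  have : (fun x : I × (Fin n → I) => nextSlot A E h x.1 x.2) ⁻¹' {s} =
      (⋂ i, {x | (IsActive h i ∧ x.2 i < A.sendProb (view h i)) ↔ i ∈ s.senders}) ∩
        {x | x.1 < E.jamProb h ↔ s.jammed = true} := by
    ext x
    obtain ⟨S, j⟩ := s
    simp only [Set.mem_preimage, Set.mem_singleton_iff, nextSlot, Slot.mk.injEq, Finset.ext_iff,
      Finset.mem_filter, Finset.mem_univ, true_and, Set.mem_inter_iff, Set.mem_iInter,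
      Set.mem_ofPred_eq]
    refine and_congr Iff.rfl ?_
    cases j <;> simp
  rw [this]
  refine MeasurableSet.inter (MeasurableSet.iInter fun i => ?_) ?_
  · refine MeasurableSet.iff ((MeasurableSet.const _).inter ?_) (MeasurableSet.const _)
    have hu : Measurable fun x : I × (Fin n → I) => x.2 i :=
      (measurable_pi_apply i).comp measurable_snd
    exact hu measurableSet_Iio
  · exact MeasurableSet.iff (measurableSet_lt measurable_fst measurable_const)
      (MeasurableSet.const _)

theorem measurable_history (A : Algorithm) (E : Adversary n d) (t : ℕ) :
    Measurable fun ω => history A E ω t := by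
  induction t with
  | zero => exact measurable_const
  | succ t ih =>
    have h1 : Measurable fun z : History n × (I × (Fin n → I)) =>
        (nextSlot A E z.1 z.2.1 z.2.2 :: z.1 : History n) :=
      measurable_from_prod_countable_right fun h =>
        (Measurable.of_discrete (f := fun s : Slot n => (s :: h : History n))).comp
          (measurable_nextSlot A E h)
    exact h1.comp (ih.prodMk (((measurable_pi_apply t).comp measurable_fst).prodMk
      ((measurable_pi_apply t).comp measurable_snd)))

/-- The integral over the next slot after the history `h`. -/
def stepInt (A : Algorithm) (E : Adversary n d) (F : Slot n → ENNReal) (h : History n) : ENNReal :=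
  ∫⁻ v : I, ∫⁻ u : Fin n → I, F (nextSlot A E h v u)

theorem history_congr {ω ω' : Coins n} {t : ℕ} (h1 : ∀ s < t, ω.1 s = ω'.1 s)
    (h2 : ∀ s < t, ω.2 s = ω'.2 s) : history A E ω t = history A E ω' t := by
  induction t with
  | zero => rfl
  | succ t ih =>
    have := ih (fun s hs => h1 s (by omega)) (fun s hs => h2 s (by omega))
    simp only [history, this, h1 t (by omega), h2 t (by omega)]

/-- The history of the first `t` slots does not depend on the coins of index `t`, so these two coins
can be resampled without changing it. This is the tower property for one slot. -/
theorem lintegral_history_succ (F : History n → ENNReal) (t : ℕ) :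
    ∫⁻ ω, F (history A E ω (t + 1)) ∂(coinMeasure n) =
      ∫⁻ ω, stepInt A E (fun s => F (s :: history A E ω t)) (history A E ω t)
        ∂(coinMeasure n) := by
  have hF : ∀ t, Measurable fun ω : Coins n => F (history A E ω t) := fun t =>
    Measurable.of_discrete.comp (measurable_history A E t)
  have hS : Measurable fun ω : Coins n =>
      stepInt A E (fun s => F (s :: history A E ω t)) (history A E ω t) :=
    (Measurable.of_discrete (f := fun h : History n => stepInt A E (fun s => F (s :: h)) h)).comp
      (measurable_history A E t)
  have hG : Measurable fun z : (Coins n) × (I × (Fin n → I)) =>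
      F (nextSlot A E (history A E z.1 t) z.2.1 z.2.2 :: history A E z.1 t) := by
    have h1 : Measurable fun z : History n × (I × (Fin n → I)) =>
        F (nextSlot A E z.1 z.2.1 z.2.2 :: z.1) :=
      measurable_from_prod_countable_right fun h =>
        (Measurable.of_discrete (f := fun s : Slot n => F (s :: h))).comp
          (measurable_nextSlot A E h)
    exact h1.comp (((measurable_history A E t).comp measurable_fst).prodMk measurable_snd)
  unfold coinMeasure at *
  rw [lintegral_prod _ (hF (t + 1)).aemeasurable, lintegral_prod _ hS.aemeasurable]
  have e1 : ∀ a : ℕ → I, ∫⁻ b, F (history A E (a, b) (t + 1))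
        ∂(Measure.infinitePi fun _ : ℕ => Measure.pi fun _ : Fin n => (volume : Measure I)) =
      ∫⁻ b, ∫⁻ u, F (nextSlot A E (history A E (a, b) t) (a t) u :: history A E (a, b) t)
        ∂(Measure.pi fun _ : Fin n => (volume : Measure I))
        ∂(Measure.infinitePi fun _ : ℕ => Measure.pi fun _ : Fin n => (volume : Measure I)) := by
    intro a
    rw [lintegral_update_infinitePi _ t (f := fun b => F (history A E (a, b) (t + 1)))
      ((hF (t + 1)).comp measurable_prodMk_left)]
    refine lintegral_congr fun b => lintegral_congr fun u => ?_
    have : history A E (a, Function.update b t u) t = history A E (a, b) t :=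
      history_congr (fun _ _ => rfl) (fun s hs => by simp [Function.update_of_ne hs.ne])
    simp [history, this]
  simp_rw [e1]
  have hmeas : Measurable fun z : (ℕ → I) × (ℕ → Fin n → I) =>
      ∫⁻ u, F (nextSlot A E (history A E z t) (z.1 t) u :: history A E z t)
        ∂(Measure.pi fun _ : Fin n => (volume : Measure I)) := by
    refine Measurable.lintegral_prod_right (f := fun (z : (ℕ → I) × (ℕ → Fin n → I)) (u : Fin n → I)
      => F (nextSlot A E (history A E z t) (z.1 t) u :: history A E z t)) ?_
    exact hG.comp (measurable_fst.prodMk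
      (((measurable_pi_apply t).comp (measurable_fst.comp measurable_fst)).prodMk measurable_snd))
  rw [lintegral_update_infinitePi _ t hmeas.lintegral_prod_right']
  refine lintegral_congr fun a => ?_
  have hm2 : Measurable fun z : I × (ℕ → Fin n → I) =>
      ∫⁻ u, F (nextSlot A E (history A E (Function.update a t z.1, z.2) t)
        (Function.update a t z.1 t) u :: history A E (Function.update a t z.1, z.2) t)
        ∂(Measure.pi fun _ : Fin n => (volume : Measure I)) :=
    hmeas.comp (((measurable_update a).comp measurable_fst).prodMk measurable_snd)
  rw [lintegral_lintegral_swap hm2.aemeasurable]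
  refine lintegral_congr fun b => ?_
  unfold stepInt
  refine lintegral_congr fun v => ?_
  have : history A E (Function.update a t v, b) t = history A E (a, b) t :=
    history_congr (fun s hs => by simp [Function.update_of_ne hs.ne]) (fun _ _ => rfl)
  simp only [this, Function.update_self]
  rfl

theorem length_history (ω : Coins n) (t : ℕ) : (history A E ω t).length = t := by
  induction t with
  | zero => rfl
  | succ t ih => simp [history, ih]

theorem lintegral_history_le {F : History n → ENNReal} {t₁ t₂ : ℕ} (h12 : t₁ ≤ t₂)
    (hF : ∀ h : History n, t₁ ≤ h.length → h.length < t₂ →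
      stepInt A E (fun s => F (s :: h)) h ≤ F h) :
    ∫⁻ ω, F (history A E ω t₂) ∂(coinMeasure n) ≤ ∫⁻ ω, F (history A E ω t₁) ∂(coinMeasure n) := by
  induction t₂, h12 using Nat.le_induction with
  | base => exact le_rfl
  | succ t ht ih =>
    refine le_trans ?_ (ih fun h h1 h2 => hF h h1 (by omega))
    rw [lintegral_history_succ]
    exact lintegral_mono fun ω => hF _ (by rw [length_history]; exact ht)
      (by rw [length_history]; omega)

open Classical in
/-- Exponential supermartingale bound: if `exp Φ`, restricted to the histories that satisfy `P`,
does not grow in expectation, then `P` is unlikely to persist while `Φ` grows from `a` to `b`. -/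
theorem measure_le_of_supermartingale {P : History n → Prop} {Φ : History n → ℝ} {t₁ t₂ : ℕ}
    {a b : ℝ} (h12 : t₁ ≤ t₂)
    (hP : ∀ (s : Slot n) (h : History n), t₁ ≤ h.length → P (s :: h) → P h)
    (hstep : ∀ h : History n, t₁ ≤ h.length → h.length < t₂ → P h →
      stepInt A E (fun s => if P (s :: h) then ENNReal.ofReal (Real.exp (Φ (s :: h))) else 0) h ≤
        ENNReal.ofReal (Real.exp (Φ h)))
    (ha : ∀ h : History n, h.length = t₁ → P h → Φ h ≤ a) :
    coinMeasure n {ω | P (history A E ω t₂) ∧ b ≤ Φ (history A E ω t₂)} ≤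
      ENNReal.ofReal (Real.exp (a - b)) := by
  set F : History n → ENNReal := fun h => if P h then ENNReal.ofReal (Real.exp (Φ h)) else 0
    with hFdef
  have h1 : ∫⁻ ω, F (history A E ω t₂) ∂(coinMeasure n) ≤ ENNReal.ofReal (Real.exp a) := by
    refine (lintegral_history_le h12 ?_).trans ?_
    · intro h hl1 hl2
      by_cases hPh : P h
      · simpa [hFdef, hPh] using hstep h hl1 hl2 hPh
      · have : ∀ s, ¬ P (s :: h) := fun s hs => hPh (hP s h hl1 hs)
        simp [hFdef, stepInt, this, hPh]
    · calc ∫⁻ ω, F (history A E ω t₁) ∂(coinMeasure n)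
          ≤ ∫⁻ _, ENNReal.ofReal (Real.exp a) ∂(coinMeasure n) := by
            refine lintegral_mono fun ω => ?_
            simp only [hFdef]
            split_ifs with hPh
            · exact ENNReal.ofReal_le_ofReal (Real.exp_le_exp.2 (ha _ (length_history _ _) hPh))
            · exact zero_le
        _ = _ := by simp
  have h2 : ENNReal.ofReal (Real.exp b) *
      coinMeasure n {ω | P (history A E ω t₂) ∧ b ≤ Φ (history A E ω t₂)} ≤
        ENNReal.ofReal (Real.exp a) := by
    refine le_trans ?_ h1
    refine le_trans ?_ (mul_meas_ge_le_lintegral (f := fun ω => F (history A E ω t₂))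
      ((Measurable.of_discrete (f := F)).comp (measurable_history A E t₂)) (ENNReal.ofReal (Real.exp b)))
    refine mul_le_mul_right (measure_mono ?_) _
    rintro ω ⟨hω1, hω2⟩
    simp only [Set.mem_ofPred_eq, hFdef, hω1, if_true]
    exact ENNReal.ofReal_le_ofReal (Real.exp_le_exp.2 hω2)
  rw [Real.exp_sub, ENNReal.ofReal_div_of_pos (Real.exp_pos b),
    ENNReal.le_div_iff_mul_le (Or.inl (by simp [Real.exp_pos])) (Or.inl ENNReal.ofReal_ne_top),
    mul_comm]
  exact h2

/-- Union bound over the slots for the event that an invariant breaks. -/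
theorem measure_not_le_of_step {P : History n → Prop} {ε : ℝ} {t₂ : ℕ} (hε : 0 ≤ ε) (h0 : P [])
    (hstep : ∀ h : History n, h.length < t₂ → P h →
      ∫⁻ v : I, (volume : Measure (Fin n → I)) {u | ¬ P (nextSlot A E h v u :: h)} ≤
        ENNReal.ofReal ε) :
    coinMeasure n {ω | ¬ P (history A E ω t₂)} ≤ ENNReal.ofReal (t₂ * ε) := by
  classical
  set F : History n → ENNReal := fun h => if P h then 0 else 1 with hFdef
  have hmeas : ∀ t, MeasurableSet {ω | ¬ P (history A E ω t)} := fun t =>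
    measurable_history A E t (MeasurableSet.of_discrete (s := {h | ¬ P h}))
  have key : ∀ t ≤ t₂, ∫⁻ ω, F (history A E ω t) ∂(coinMeasure n) ≤ ENNReal.ofReal (t * ε) := by
    intro t
    induction t with
    | zero => intro _; simp [hFdef, history, h0]
    | succ t ih =>
      intro ht
      rw [lintegral_history_succ]
      calc _ ≤ ∫⁻ ω, (F (history A E ω t) + ENNReal.ofReal ε) ∂(coinMeasure n) := by
            refine lintegral_mono fun ω => ?_
            set h := history A E ω t with hh
            have hl : h.length < t₂ := by rw [hh, length_history]; omega
            by_cases hPh : P h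
            · refine le_trans ?_ ((hstep h hl hPh).trans le_add_self)
              unfold stepInt
              refine lintegral_mono fun v => ?_
              have : ∀ u, F (nextSlot A E h v u :: h) =
                  Set.indicator {u | ¬ P (nextSlot A E h v u :: h)} 1 u := by
                intro u
                by_cases hp : P (nextSlot A E h v u :: h) <;> simp [hFdef, hp]
              simp_rw [this]
              exact lintegral_indicator_one_le _
            · have h1 : F h = 1 := by simp [hFdef, hPh]
              rw [h1]
              refine le_trans ?_ le_self_add
              unfold stepInt
              calc _ ≤ ∫⁻ _ : I, ∫⁻ _ : Fin n → I, (1 : ENNReal) := by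
                    refine lintegral_mono fun v => lintegral_mono fun u => ?_
                    simp only [hFdef]; split_ifs <;> simp
                _ = 1 := by simp
        _ = (∫⁻ ω, F (history A E ω t) ∂(coinMeasure n)) + ENNReal.ofReal ε := by
            rw [lintegral_add_right _ measurable_const]; simp
        _ ≤ ENNReal.ofReal (t * ε) + ENNReal.ofReal ε := by gcongr; exact ih (by omega)
        _ = _ := by
            rw [← ENNReal.ofReal_add (by positivity) hε]; push_cast; ring_nf
  refine le_trans (le_of_eq ?_) (key t₂ le_rfl)
  have : ∀ ω, F (history A E ω t₂) = Set.indicator {ω | ¬ P (history A E ω t₂)} 1 ω := by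
    intro ω
    by_cases hp : P (history A E ω t₂) <;> simp [hFdef, hp]
  simp_rw [this]
  rw [lintegral_indicator_one (hmeas t₂)]

/-! ### The law of a single slot -/

open Classical in
/-- The nodes that are active after the history `h`. -/
def activeSet (h : History n) : Finset (Fin n) := Finset.univ.filter (IsActive h)

theorem mem_activeSet {h : History n} {i : Fin n} : i ∈ activeSet h ↔ IsActive h i := by
  simp [activeSet]

/-- The number of nodes that are active after the history `h`. -/
def numActive (h : History n) : ℕ := (activeSet h).card

theorem IsActive.tail {s : Slot n} {h : History n} {i : Fin n} (hi : IsActive (s :: h) i) :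
    IsActive h i := fun s' hs' => hi s' (List.mem_cons_of_mem _ hs')

theorem activeSet_cons_subset (s : Slot n) (h : History n) : activeSet (s :: h) ⊆ activeSet h :=
  fun _ hi => mem_activeSet.2 (mem_activeSet.1 hi).tail

theorem numActive_cons_le (s : Slot n) (h : History n) : numActive (s :: h) ≤ numActive h :=
  Finset.card_le_card (activeSet_cons_subset s h)

theorem numActive_le (h : History n) : numActive h ≤ n :=
  (Finset.card_le_univ (activeSet h)).trans_eq (Fintype.card_fin n)

theorem not_isActive_cons_singleton (h : History n) (i : Fin n) :
    ¬ IsActive (⟨{i}, false⟩ :: h) i := fun hi => hi _ List.mem_cons_self ⟨rfl, rfl⟩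

theorem numActive_cons_singleton {h : History n} {i : Fin n} (hi : i ∈ activeSet h) :
    numActive (⟨{i}, false⟩ :: h) + 1 ≤ numActive h := by
  refine Finset.card_lt_card (Finset.ssubset_iff_subset_ne.2 ⟨activeSet_cons_subset _ _, ?_⟩)
  intro heq
  rw [← heq] at hi
  exact not_isActive_cons_singleton h i (mem_activeSet.1 hi)

theorem numActive_pos_iff {h : History n} : 1 ≤ numActive h ↔ ∃ i, IsActive h i := by
  simp only [numActive, Nat.one_le_iff_ne_zero, ← Nat.pos_iff_ne_zero, Finset.card_pos,
    Finset.Nonempty, mem_activeSet]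

open Classical in
/-- The nodes that broadcast in the slot after the history `h`. -/
def sendersOf (A : Algorithm) (h : History n) (u : Fin n → I) : Finset (Fin n) :=
  Finset.univ.filter fun i => IsActive h i ∧ u i < A.sendProb (view h i)

theorem nextSlot_eq (h : History n) (v : I) (u : Fin n → I) :
    nextSlot A E h v u = ⟨sendersOf A h u, decide (v < E.jamProb h)⟩ := rfl

theorem measurableSet_sendersOf (A : Algorithm) (h : History n) (S : Set (Finset (Fin n))) :
    MeasurableSet {u | sendersOf A h u ∈ S} := by
  have h1 : Measurable fun u : Fin n → I =>
      nextSlot A (⟨fun _ => 0, fun _ _ => rfl⟩ : Adversary n 0) h 0 u :=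
    (measurable_nextSlot A _ h).comp measurable_prodMk_left
  exact h1 (MeasurableSet.of_discrete (s := {s : Slot n | s.senders ∈ S}))

/-- Because `x ≤ y`, the two-valued bound decreases in the probability of `S`, so a lower bound `q`
on that probability is enough. -/
theorem lintegral_senders_le (h : History n) {G : Finset (Fin n) → ENNReal} {x y q : ℝ}
    (S : Set (Finset (Fin n))) (hx : 0 ≤ x) (hxy : x ≤ y)
    (hS : ∀ R ∈ S, G R ≤ ENNReal.ofReal x) (hN : ∀ R, G R ≤ ENNReal.ofReal y)
    (hq : ENNReal.ofReal q ≤ (volume : Measure (Fin n → I)) {u | sendersOf A h u ∈ S}) :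
    ∫⁻ u : Fin n → I, G (sendersOf A h u) ≤ ENNReal.ofReal (q * x + (1 - q) * y) := by
  classical
  set S' : Set (Fin n → I) := {u | sendersOf A h u ∈ S} with hS'
  have hm : MeasurableSet S' := measurableSet_sendersOf A h S
  set r : ℝ := (volume : Measure (Fin n → I)).real S' with hr
  have hr1 : r ≤ 1 := measureReal_le_one
  have hr0 : 0 ≤ r := measureReal_nonneg
  have hvol : (volume : Measure (Fin n → I)) S' = ENNReal.ofReal r := by
    rw [hr, ofReal_measureReal]
  have hvolc : (volume : Measure (Fin n → I)) S'ᶜ = ENNReal.ofReal (1 - r) := by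
    rw [prob_compl_eq_one_sub hm, hvol, ENNReal.ofReal_sub _ hr0, ENNReal.ofReal_one]
  have hqr : q ≤ r := by
    rw [hvol] at hq
    exact (ENNReal.ofReal_le_ofReal_iff hr0).1 hq
  calc ∫⁻ u : Fin n → I, G (sendersOf A h u)
      ≤ ∫⁻ u : Fin n → I, (S'.indicator (fun _ => ENNReal.ofReal x) u +
          S'ᶜ.indicator (fun _ => ENNReal.ofReal y) u) := by
        refine lintegral_mono fun u => ?_
        by_cases hu : u ∈ S'
        · simpa [hu] using hS _ hu
        · simpa [hu] using hN _
    _ = ENNReal.ofReal (x * r + y * (1 - r)) := by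
        rw [lintegral_add_left (measurable_const.indicator hm),
          lintegral_indicator_const hm, lintegral_indicator_const hm.compl, hvol, hvolc,
          ← ENNReal.ofReal_mul hx, ← ENNReal.ofReal_mul (hx.trans hxy),
          ← ENNReal.ofReal_add (by positivity)
            (mul_nonneg (hx.trans hxy) (by linarith))]
    _ ≤ _ := ENNReal.ofReal_le_ofReal (by nlinarith)

theorem stepInt_le_of_forall {h : History n} {G : Slot n → ENNReal} {a : ENNReal}
    (hG : ∀ s, G s ≤ a) : stepInt A E G h ≤ a := by
  unfold stepInt
  calc _ ≤ ∫⁻ _ : I, ∫⁻ _ : Fin n → I, a := lintegral_mono fun v => lintegral_mono fun u => hG _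
    _ = a := by simp

/-- One step of a supermartingale that is compensated in jammed slots and when the set of
broadcasting nodes belongs to `S`. -/
theorem stepInt_le (h : History n) {G : Slot n → ENNReal} {a x y q : ℝ}
    (S : Set (Finset (Fin n))) (hx : 0 ≤ x) (hxy : x ≤ y)
    (hjam : ∀ R, G ⟨R, true⟩ ≤ ENNReal.ofReal a)
    (hS : ∀ R ∈ S, G ⟨R, false⟩ ≤ ENNReal.ofReal x) (hN : ∀ R, G ⟨R, false⟩ ≤ ENNReal.ofReal y)
    (hq : ENNReal.ofReal q ≤ (volume : Measure (Fin n → I)) {u | sendersOf A h u ∈ S})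
    (hqa : q * x + (1 - q) * y ≤ a) :
    stepInt A E G h ≤ ENNReal.ofReal a := by
  unfold stepInt
  calc _ ≤ ∫⁻ _ : I, ENNReal.ofReal a := by
        refine lintegral_mono fun v => ?_
        by_cases hv : v < E.jamProb h
        · calc _ ≤ ∫⁻ _ : Fin n → I, ENNReal.ofReal a := by
                refine lintegral_mono fun u => ?_
                rw [nextSlot_eq]
                simpa [hv] using hjam _
            _ = _ := by simp
        · refine le_trans (le_of_eq ?_) ((lintegral_senders_le h (G := fun R => G ⟨R, false⟩) S hx
            hxy hS hN hq).trans (ENNReal.ofReal_le_ofReal hqa))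
          refine lintegral_congr fun u => ?_
          rw [nextSlot_eq]
          simp [hv]
    _ = _ := by simp

/-- The event is a box: coin `i` falls below `p`, the coins of the other active nodes do not, and
the coins of inactive nodes are free. -/
theorem volume_sendersOf_eq_singleton {h : History n} {p : I}
    (hp : ∀ i, A.sendProb (view h i) = p) {i : Fin n} (hi : i ∈ activeSet h) :
    (volume : Measure (Fin n → I)) {u | sendersOf A h u = {i}} =
      ENNReal.ofReal (p * (1 - p) ^ (numActive h - 1)) := by
  classical
  have hset : {u : Fin n → I | sendersOf A h u = {i}} = Set.pi Set.univ fun j =>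
      if j = i then Set.Iio p else if j ∈ activeSet h then Set.Ici p else Set.univ := by
    ext u
    simp only [sendersOf, hp, Finset.ext_iff, Finset.mem_filter, Finset.mem_univ, true_and,
      Finset.mem_singleton, Set.mem_ofPred_eq, Set.mem_pi, Set.mem_univ, true_implies]
    refine forall_congr' fun j => ?_
    by_cases hj : j = i
    · subst hj
      simp [mem_activeSet.1 hi]
    · by_cases hja : j ∈ activeSet h
      · simp [hj, hja, mem_activeSet.1 hja]
      · simpa [hj, hja] using fun hh => absurd (mem_activeSet.2 hh) hja
  rw [hset, volume_pi, Measure.pi_pi, ← Finset.mul_prod_erase _ _ (Finset.mem_univ i)]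
  have h2 : ∏ j ∈ Finset.univ.erase i, (volume : Measure I)
      (if j = i then Set.Iio p else if j ∈ activeSet h then Set.Ici p else Set.univ) =
      ENNReal.ofReal (1 - p) ^ (numActive h - 1) := by
    rw [numActive, ← Finset.card_erase_of_mem hi, ← Finset.prod_const]
    refine (Finset.prod_subset_one_on_sdiff (Finset.erase_subset_erase i
      (Finset.subset_univ (activeSet h))) ?_ ?_).symm
    · intro j hj
      simp only [Finset.mem_sdiff, Finset.mem_erase, Finset.mem_univ, and_true, not_and] at hj
      simp [hj.1, hj.2 hj.1]
    · intro j hj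
      simp only [Finset.mem_erase] at hj
      simp [hj.1, hj.2]
  rw [h2]
  have h1p : (0:ℝ) ≤ 1 - p := by linarith [p.2.2]
  rw [ENNReal.ofReal_mul p.2.1, ENNReal.ofReal_pow h1p]
  simp

theorem volume_sendersOf_singleton {h : History n} {p : I}
    (hp : ∀ i, A.sendProb (view h i) = p) :
    (volume : Measure (Fin n → I)) {u | ∃ i ∈ activeSet h, sendersOf A h u = {i}} =
      ENNReal.ofReal (numActive h * (p * (1 - p) ^ (numActive h - 1))) := by
  have hset : {u : Fin n → I | ∃ i ∈ activeSet h, sendersOf A h u = {i}} =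
      ⋃ i ∈ activeSet h, {u | sendersOf A h u = {i}} := by
    ext u; simp
  rw [hset, measure_biUnion_finset]
  · rw [Finset.sum_congr rfl fun i hi => volume_sendersOf_eq_singleton hp hi, Finset.sum_const,
      ENNReal.ofReal_mul (Nat.cast_nonneg _), nsmul_eq_mul, ENNReal.ofReal_natCast]
    rfl
  · intro i _ j _ hij
    refine Set.disjoint_left.2 fun u hu hu' => hij ?_
    simp only [Set.mem_ofPred_eq] at hu hu'
    rw [hu] at hu'
    exact Finset.singleton_injective hu'
  · intro i _
    exact measurableSet_sendersOf A h {{i}}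

/-- Jamming can only destroy a success, hence an inequality, uniform in the adversary's coin. -/
theorem volume_hasSuccess_le {h : History n} {p : I} (hp : ∀ i, A.sendProb (view h i) = p)
    (v : I) :
    (volume : Measure (Fin n → I)) {u | (nextSlot A E h v u).HasSuccess} ≤
      ENNReal.ofReal (numActive h * (p * (1 - p) ^ (numActive h - 1))) := by
  rw [← volume_sendersOf_singleton hp]
  refine measure_mono fun u hu => ?_
  obtain ⟨i, -, hi⟩ := hu
  have hi' : sendersOf A h u = {i} := hi
  refine ⟨i, ?_, hi'⟩
  have : i ∈ sendersOf A h u := by rw [hi']; exact Finset.mem_singleton_self i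
  simp only [sendersOf, Finset.mem_filter] at this
  exact mem_activeSet.2 this.2.1

theorem le_volume_notMem_sendersOf {h : History n} {p : I} (i : Fin n)
    (hp : A.sendProb (view h i) = p) :
    ENNReal.ofReal (1 - p) ≤
      (volume : Measure (Fin n → I)) {u | sendersOf A h u ∈ {R : Finset (Fin n) | i ∉ R}} := by
  have h1 : (volume : Measure (Fin n → I)) ((fun u : Fin n → I => u i) ⁻¹' Set.Ici p) =
      ENNReal.ofReal (1 - p) := by
    rw [volume_pi, (measurePreserving_eval (fun _ : Fin n => (volume : Measure I)) i).measure_preimage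
      measurableSet_Ici.nullMeasurableSet]
    simp
  rw [← h1]
  refine measure_mono fun u hu => ?_
  simp only [Set.mem_preimage, Set.mem_Ici] at hu
  simp [sendersOf, hp, hu]

/-! ### Exponential bounds for the probability that the other nodes stay silent -/

theorem exp_neg_le_one_sub {x : ℝ} (h0 : 0 ≤ x) (h1 : x ≤ 1 / 2) :
    Real.exp (-(2 * x)) ≤ 1 - x := by
  have h2 : 1 + 2 * x ≤ Real.exp (2 * x) := by linarith [Real.add_one_le_exp (2 * x)]
  rw [Real.exp_neg]
  calc (Real.exp (2 * x))⁻¹ ≤ (1 + 2 * x)⁻¹ := inv_anti₀ (by linarith) h2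
    _ ≤ 1 - x := by
      rw [inv_le_iff_one_le_mul₀ (by linarith)]
      nlinarith

theorem exp_le_one_sub_pow {p : ℝ} (h0 : 0 ≤ p) (h1 : p ≤ 1 / 2) (N : ℕ) :
    Real.exp (-(2 * (N * p))) ≤ (1 - p) ^ (N - 1) := by
  calc Real.exp (-(2 * (N * p))) = Real.exp (-(2 * p)) ^ N := by
        rw [← Real.exp_nat_mul]; ring_nf
    _ ≤ (1 - p) ^ N := pow_le_pow_left₀ (Real.exp_pos _).le (exp_neg_le_one_sub h0 h1) N
    _ ≤ (1 - p) ^ (N - 1) := pow_le_pow_of_le_one (by linarith) (by linarith) (Nat.sub_le _ _)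

theorem one_sub_pow_le_exp {p : ℝ} (h1 : p ≤ 1) {N : ℕ} (hp : 0 ≤ p) (hN : 2 ≤ N) :
    (1 - p) ^ (N - 1) ≤ Real.exp (-(N * p / 2)) := by
  have hN' : (2:ℝ) ≤ N := by exact_mod_cast hN
  calc (1 - p) ^ (N - 1) ≤ Real.exp (-p) ^ (N - 1) :=
        pow_le_pow_left₀ (by linarith) (by linarith [Real.add_one_le_exp (-p)]) _
    _ = Real.exp (-(((N - 1 : ℕ) : ℝ) * p)) := by rw [← Real.exp_nat_mul]; ring_nf
    _ ≤ _ := by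
      refine Real.exp_le_exp.2 ?_
      rw [Nat.cast_sub (by omega)]
      push_cast
      nlinarith

/-! ### The common state of the active nodes -/

theorem State.update_one_false_top (l : ℝ) (t : ℕ) :
    (State.one l t ⊤).update false = .one (l + 1) (t + 1) ⊤ := by
  simp [State.update]

theorem State.update_one_false_coe (l : ℝ) (t : ℕ) (m : ℝ) :
    (State.one l t m).update false =
      if m ≤ ((t + 1 : ℕ) : ℝ) / Real.log ((t + 1 : ℕ) : ℝ) then .two 1
      else .one (l + 1) (t + 1) m := by
  simp only [State.update, WithTop.coe_le_coe, Bool.false_eq_true, if_false]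

theorem State.update_one_true_top (l : ℝ) (t : ℕ) :
    (State.one l t ⊤).update true =
      if max (l / 2) 1 ≤ ((t + 1 : ℕ) : ℝ) / Real.log ((t + 1 : ℕ) : ℝ) then .two 1
      else .one (max (l / 2) 1) (t + 1) (max (l / 2) 1 : ℝ) := by
  simp only [State.update, if_true, min_eq_right le_top, WithTop.coe_le_coe]

theorem State.update_one_true_coe (l : ℝ) (t : ℕ) (m : ℝ) :
    (State.one l t m).update true =
      if min m (max (l / 2) 1) ≤ ((t + 1 : ℕ) : ℝ) / Real.log ((t + 1 : ℕ) : ℝ) then .two 1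
      else .one (max (l / 2) 1) (t + 1) (min m (max (l / 2) 1) : ℝ) := by
  simp only [State.update, if_true, ← WithTop.coe_min, WithTop.coe_le_coe]

/-- What holds for the state after `k` rounds. -/
def State.Valid (k : ℕ) : State → Prop
  | .one l t m => t = k + 1 ∧ 1 ≤ l ∧ l ≤ t ∧
      ((m = ⊤ ∧ l = t) ∨ ∃ μ : ℝ, m = μ ∧ 2 ≤ t ∧ μ ≤ l ∧ (t : ℝ) / Real.log t < μ)
  | .two x => 1 ≤ x ∧ x ≤ k

/-- Before the first control success `l` and `t` grow together. A success makes `m` at most the new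
`l`, and failures only raise `l`, so `m ≤ l` persists. Surviving the phase test means `t / log t <
m`; this test comes after the increment of `t`, so `2 ≤ t` and the logarithm is positive. -/
theorem State.Valid.update {k : ℕ} {s : State} (hs : s.Valid k) (b : Bool) :
    (s.update b).Valid (k + 1) := by
  cases s with
  | two x =>
    obtain ⟨h1, h2⟩ := hs
    exact ⟨by omega, by omega⟩
  | one l t m =>
    obtain ⟨rfl, h1, h2, h3⟩ := hs
    push_cast at h2
    rcases h3 with ⟨rfl, h3⟩ | ⟨μ, rfl, h3, h4, h5⟩
    · cases b with
      | false =>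
        rw [State.update_one_false_top]
        refine ⟨rfl, by linarith, by push_cast; linarith, Or.inl ⟨rfl, ?_⟩⟩
        rw [h3]; push_cast; ring
      | true =>
        rw [State.update_one_true_top]
        split_ifs with hc
        · exact ⟨le_rfl, by omega⟩
        · refine ⟨rfl, le_max_right _ _, ?_, Or.inr ⟨_, rfl, by omega, le_rfl, not_le.1 hc⟩⟩
          push_cast
          exact max_le (by linarith) (by linarith)
    · cases b with
      | false =>
        rw [State.update_one_false_coe]
        split_ifs with hc
        · exact ⟨le_rfl, by omega⟩
        · refine ⟨rfl, by linarith, by push_cast; linarith,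
            Or.inr ⟨_, rfl, by omega, by linarith, not_le.1 hc⟩⟩
      | true =>
        rw [State.update_one_true_coe]
        split_ifs with hc
        · exact ⟨le_rfl, by omega⟩
        · refine ⟨rfl, le_max_right _ _, ?_, Or.inr ⟨_, rfl, by omega, min_le_right _ _,
            not_le.1 hc⟩⟩
          push_cast
          exact max_le (by linarith) (by linarith)

/-- The state reads only the channel feedback, never the node's own broadcasts. Hence all nodes
share it. -/
theorem stateOf_congr {w w' : View} (h : w.map Prod.snd = w'.map Prod.snd) :
    stateOf w = stateOf w' := by
  induction w generalizing w' with
  | nil =>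
    cases w' with
    | nil => rfl
    | cons a w' => simp at h
  | cons a w ih =>
    cases w' with
    | nil => simp at h
    | cons a' w' =>
      obtain ⟨a1, a2⟩ := a
      obtain ⟨b1, b2⟩ := a'
      simp only [List.map_cons, List.cons.injEq] at h
      have hl : w.length = w'.length := by simpa using congrArg List.length h.2
      simp only [stateOf, ih h.2, hl, h.1]

open Classical in
/-- The state that all nodes have after the history `h`. -/
def gstate (h : History n) : State := stateOf (h.map fun s => (false, decide s.HasSuccess))

theorem stateOf_view (h : History n) (i : Fin n) : stateOf (view h i) = gstate h :=
  stateOf_congr (by simp [view])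

open Classical in
theorem gstate_cons (s : Slot n) (h : History n) :
    gstate (s :: h) =
      if Odd h.length then (gstate h).update (decide s.HasSuccess) else gstate h := by
  simp [gstate, stateOf]

theorem gstate_cons_even {s : Slot n} {h : History n} (hh : Even h.length) :
    gstate (s :: h) = gstate h := by
  rw [gstate_cons, if_neg (Nat.not_odd_iff_even.2 hh)]

theorem gstate_valid (h : History n) : (gstate h).Valid (h.length / 2) := by
  induction h with
  | nil => exact ⟨by simp, le_rfl, by simp, Or.inl ⟨rfl, by simp⟩⟩
  | cons s h ih =>
    rw [gstate_cons]
    split_ifs with ho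
    · have : (s :: h).length / 2 = h.length / 2 + 1 := by
        obtain ⟨k, hk⟩ := ho
        simp only [List.length_cons]
        omega
      rw [this]
      exact ih.update _
    · have : (s :: h).length / 2 = h.length / 2 := by
        obtain ⟨k, hk⟩ := Nat.not_odd_iff_even.1 ho
        simp only [List.length_cons]
        omega
      rwa [this]

/-- The broadcasting probability of the active nodes after the history `h`. -/
def bcastProb (c : ℝ) (h : History n) : ℝ :=
  if Even h.length then (gstate h).dataProb else (gstate h).controlProb c

theorem State.Valid.dataProb_mem {k : ℕ} {s : State} (hs : s.Valid k) :
    s.dataProb ∈ Set.Icc (0 : ℝ) 1 := by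
  cases s with
  | one l t m =>
    have : 1 ≤ l := hs.2.1
    exact ⟨le_min (by positivity) zero_le_one, min_le_right _ _⟩
  | two x => exact ⟨le_rfl, zero_le_one⟩

theorem State.Valid.controlProb_mem {k : ℕ} {s : State} (hs : s.Valid k) {c : ℝ} (hc : 0 ≤ c) :
    s.controlProb c ∈ Set.Icc (0 : ℝ) 1 := by
  cases s with
  | one l t m =>
    have : 1 ≤ l := hs.2.1
    have := Real.log_nonneg this
    exact ⟨le_min (by positivity) zero_le_one, min_le_right _ _⟩
  | two x =>
    have : 0 ≤ Real.log x := Real.log_natCast_nonneg x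
    exact ⟨le_min (by positivity) zero_le_one, min_le_right _ _⟩

theorem bcastProb_mem {c : ℝ} (hc : 0 ≤ c) (h : History n) :
    bcastProb c h ∈ Set.Icc (0 : ℝ) 1 := by
  unfold bcastProb
  split_ifs
  · exact (gstate_valid h).dataProb_mem
  · exact (gstate_valid h).controlProb_mem hc

theorem sendProb_view {c : ℝ} (hc : 0 ≤ c) (h : History n) (i : Fin n) :
    (twoPhaseAlgorithm c).sendProb (view h i) = ⟨bcastProb c h, bcastProb_mem hc h⟩ := by
  have : (view h i).length = h.length := by simp [view]
  simp only [twoPhaseAlgorithm, stateOf_view, this]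
  exact Set.projIcc_of_mem _ (bcastProb_mem hc h)

/-! ### The total broadcasting probability -/

/-- The reciprocal of the variable that governs the broadcasting probability. -/
def State.rate : State → ℝ
  | .one l _ _ => 1 / l
  | .two x => 1 / x

/-- The sum of the rates of all the slots of a history. -/
def totalRate : History n → ℝ
  | [] => 0
  | _ :: h => totalRate h + (gstate h).rate

/-- The potential that dominates twice the sum of the rates of the past rounds. -/
def State.rateBound (k : ℕ) : State → ℝ
  | .one _ t ⊤ => 4 * Real.log t
  | .one _ t (WithTop.some μ) => 4 * Real.log t + 2 * (t - 1) / μ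
  | .two x => 6 * Real.log (k + 1) + 4 * Real.log x

theorem one_div_le_log_sub {x : ℝ} (hx : 1 ≤ x) :
    1 / x ≤ 2 * (Real.log (x + 1) - Real.log x) := by
  have h1 : Real.log (x / (x + 1)) ≤ x / (x + 1) - 1 :=
    Real.log_le_sub_one_of_pos (by positivity)
  rw [Real.log_div (by positivity) (by positivity)] at h1
  have h2 : x / (x + 1) - 1 = -(1 / (x + 1)) := by field_simp; ring
  have h3 : 1 / x ≤ 2 * (1 / (x + 1)) := by
    rw [mul_one_div, div_le_div_iff₀ (by positivity) (by positivity)]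
    linarith
  linarith

/-- The factor `2` counts the two slots of a round. While `m = ∞` the rate is `1 / t`, paid by the
growth of `4 * log t`. Once `m` is finite the rate is at most `1 / m`, paid by `2 * (t - 1) / m`,
and lowering `m` only raises this term. Phase two is paid by the growth of `4 * log x`. -/
theorem State.Valid.rateBound_update {k : ℕ} {s : State} (hs : s.Valid k) (b : Bool) :
    s.rateBound k + 2 * s.rate ≤ (s.update b).rateBound (k + 1) := by
  cases s with
  | two x =>
    obtain ⟨h1, h2⟩ := hs
    have h1' : (1:ℝ) ≤ x := by exact_mod_cast h1
    have := one_div_le_log_sub h1'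
    have h3 : Real.log ((k:ℝ) + 1) ≤ Real.log (((k + 1 : ℕ) : ℝ) + 1) :=
      Real.log_le_log (by positivity) (by push_cast; linarith)
    simp only [State.rateBound, State.rate, State.update]
    push_cast at h3 ⊢
    linarith
  | one l t m =>
    have hs' := hs.update b
    obtain ⟨rfl, h1, h2, h3⟩ := hs
    have ht : (1:ℝ) ≤ ((k + 1 : ℕ) : ℝ) := by push_cast; linarith [Nat.cast_nonneg (α := ℝ) k]
    have hlog := one_div_le_log_sub ht
    have hk : (0:ℝ) ≤ k := Nat.cast_nonneg k
    have hl2 : 0 ≤ Real.log ((k:ℝ) + 1 + 1) := Real.log_nonneg (by linarith)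
    rcases h3 with ⟨rfl, h3⟩ | ⟨μ, rfl, h3, h4, h5⟩
    · have key : State.rateBound k (.one l (k + 1) ⊤) + 2 * (State.one l (k + 1) ⊤).rate ≤
          4 * Real.log ((k:ℝ) + 1 + 1) := by
        simp only [State.rateBound, State.rate, h3]
        push_cast at hlog ⊢
        linarith
      refine key.trans ?_
      cases b with
      | false =>
        rw [State.update_one_false_top]
        simp only [State.rateBound]
        push_cast
        exact le_rfl
      | true =>
        rw [State.update_one_true_top]
        split_ifs with hc
        · simp only [State.rateBound]
          push_cast
          rw [Real.log_one]
          linarith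
        · simp only [State.rateBound]
          have : (0:ℝ) ≤ 2 * (((k + 1 + 1 : ℕ) : ℝ) - 1) / (max (l / 2) 1) := by
            push_cast
            have : (0:ℝ) < max (l / 2) 1 := by positivity
            apply div_nonneg <;> linarith
          push_cast at this ⊢
          linarith
    · have hk1 : (1:ℝ) ≤ k := by
        have : 1 ≤ k := by omega
        exact_mod_cast this
      have hlk : 0 < Real.log ((k + 1 : ℕ) : ℝ) := Real.log_pos (by push_cast; linarith)
      have hμ : 0 < μ := lt_of_le_of_lt (by positivity) h5
      have key : State.rateBound k (.one l (k + 1) μ) + 2 * (State.one l (k + 1) μ).rate ≤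
          4 * Real.log ((k:ℝ) + 1 + 1) + 2 * (k + 1) / μ := by
        simp only [State.rateBound, State.rate]
        have h6 : 1 / l ≤ 1 / μ := one_div_le_one_div_of_le hμ h4
        have h8 : 2 * ((k:ℝ) + 1) / μ = 2 * k / μ + 2 * (1 / μ) := by ring
        have h9 : 2 * (((k + 1 : ℕ) : ℝ) - 1) / μ = 2 * k / μ := by push_cast; ring
        have h10 : 0 ≤ 1 / (((k + 1 : ℕ) : ℝ)) := by positivity
        rw [h8, h9]
        push_cast at hlog h10 ⊢
        linarith
      refine key.trans ?_
      -- The previous round did not end phase one, so the old `μ` exceeds `t / log t`. The term with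
      -- `μ` is thus at most two logarithms, and the bound `6 * log` of phase two covers a switch.
      have h7 : 2 * ((k:ℝ) + 1) / μ ≤ 2 * Real.log ((k:ℝ) + 1 + 1) := by
        have h8 : Real.log ((k + 1 : ℕ) : ℝ) ≤ Real.log ((k:ℝ) + 1 + 1) :=
          Real.log_le_log (by positivity) (by push_cast; linarith)
        rw [div_le_iff₀ hμ]
        rw [div_lt_iff₀ hlk] at h5
        push_cast at h5 h8
        nlinarith
      have hmono : ∀ μ' : ℝ, μ' ≤ μ → 0 < μ' →
          4 * Real.log ((k:ℝ) + 1 + 1) + 2 * ((k:ℝ) + 1) / μ ≤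
          State.rateBound (k + 1) (.one l (k + 1 + 1) μ') := by
        intro μ' h10 h11
        simp only [State.rateBound]
        have : 2 * ((k:ℝ) + 1) / μ ≤ 2 * ((k:ℝ) + 1) / μ' :=
          div_le_div_of_nonneg_left (by positivity) h11 h10
        have h9 : 2 * (((k + 1 + 1 : ℕ) : ℝ) - 1) / μ' = 2 * ((k:ℝ) + 1) / μ' := by push_cast; ring
        rw [h9]
        push_cast
        linarith
      have htwo : 4 * Real.log ((k:ℝ) + 1 + 1) + 2 * ((k:ℝ) + 1) / μ ≤
          State.rateBound (k + 1) (.two 1) := by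
        simp only [State.rateBound]
        push_cast
        rw [Real.log_one]
        linarith
      cases b with
      | false =>
        rw [State.update_one_false_coe]
        split_ifs with hc
        · exact htwo
        · exact hmono μ le_rfl hμ
      | true =>
        rw [State.update_one_true_coe]
        split_ifs with hc
        · exact htwo
        · refine hmono _ (min_le_left _ _) (lt_min hμ (by positivity))

theorem State.Valid.rate_nonneg {k : ℕ} {s : State} (hs : s.Valid k) : 0 ≤ s.rate := by
  cases s with
  | one l t m => exact div_nonneg zero_le_one (zero_le_one.trans hs.2.1)
  | two x => exact div_nonneg zero_le_one (Nat.cast_nonneg _)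

theorem State.Valid.rate_le_one {k : ℕ} {s : State} (hs : s.Valid k) : s.rate ≤ 1 := by
  cases s with
  | one l t m => exact div_le_one_of_le₀ hs.2.1 (zero_le_one.trans hs.2.1)
  | two x =>
    have : (1:ℝ) ≤ x := by exact_mod_cast hs.1
    exact div_le_one_of_le₀ this (by linarith)

theorem State.Valid.rateBound_le {k : ℕ} {s : State} (hs : s.Valid k) :
    s.rateBound k ≤ 10 * Real.log (k + 1) := by
  have hk : (0:ℝ) ≤ k := Nat.cast_nonneg k
  have hlk : 0 ≤ Real.log ((k:ℝ) + 1) := Real.log_nonneg (by linarith)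
  cases s with
  | one l t m =>
    obtain ⟨rfl, h1, h2, h3⟩ := hs
    rcases h3 with ⟨rfl, h3⟩ | ⟨μ, rfl, h3, h4, h5⟩
    · simp only [State.rateBound]
      push_cast
      linarith
    · have hk1 : (1:ℝ) ≤ k := by
        have : 1 ≤ k := by omega
        exact_mod_cast this
      have hlk : 0 < Real.log ((k + 1 : ℕ) : ℝ) := Real.log_pos (by push_cast; linarith)
      have hμ : 0 < μ := lt_of_le_of_lt (by positivity) h5
      have h6 : 2 * (((k + 1 : ℕ) : ℝ) - 1) / μ ≤ 2 * Real.log ((k + 1 : ℕ) : ℝ) := by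
        rw [div_le_iff₀ hμ]
        rw [div_lt_iff₀ hlk] at h5
        nlinarith
      simp only [State.rateBound]
      push_cast at h6 hlk ⊢
      linarith
  | two x =>
    obtain ⟨h1, h2⟩ := hs
    have h1' : (1:ℝ) ≤ x := by exact_mod_cast h1
    have h2' : (x:ℝ) ≤ k := by exact_mod_cast h2
    have : Real.log x ≤ Real.log ((k:ℝ) + 1) := Real.log_le_log (by linarith) (by linarith)
    simp only [State.rateBound]
    linarith

-- Induction over slots; for an odd length the first slot of the current round has been counted, but
-- the potential has not moved yet, hence the extra rate, at most `1`.
open Classical in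
theorem totalRate_le (h : History n) :
    totalRate h ≤ 10 * Real.log ((h.length / 2 : ℕ) + 1) + 1 := by
  have key : totalRate h ≤ (gstate h).rateBound (h.length / 2) +
      if Odd h.length then (gstate h).rate else 0 := by
    induction h with
    | nil => simp [totalRate, gstate, stateOf, State.init, State.rateBound]
    | cons s h ih =>
      rw [totalRate, gstate_cons]
      rcases Nat.even_or_odd h.length with he | ho
      · have h1 : ¬ Odd h.length := Nat.not_odd_iff_even.2 he
        have h2 : Odd (s :: h).length := by simpa using he.add_one
        have h3 : (s :: h).length / 2 = h.length / 2 := by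
          obtain ⟨k, hk⟩ := he
          simp only [List.length_cons]
          omega
        rw [if_neg h1] at ih
        rw [if_neg h1, if_pos h2, h3]
        linarith
      · have h2 : ¬ Odd (s :: h).length := by simpa using ho.add_one
        have h3 : (s :: h).length / 2 = h.length / 2 + 1 := by
          obtain ⟨k, hk⟩ := ho
          simp only [List.length_cons]
          omega
        rw [if_pos ho] at ih
        rw [if_pos ho, if_neg h2, h3]
        have := (gstate_valid h).rateBound_update (decide s.HasSuccess)
        linarith
  have h1 := (gstate_valid h).rateBound_le
  have h2 := (gstate_valid h).rate_le_one
  split_ifs at key <;> linarith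

theorem bcastProb_le {c : ℝ} (hc : 0 ≤ c) (h : History n) {k : ℕ} (hk : h.length / 2 ≤ k) :
    bcastProb c h ≤ (1 + c * Real.log (k + 1)) * (gstate h).rate := by
  have hv := gstate_valid h
  have hk' : ((h.length / 2 : ℕ) : ℝ) ≤ k := by exact_mod_cast hk
  have hk0 : (0:ℝ) ≤ (h.length / 2 : ℕ) := Nat.cast_nonneg _
  have hl : 0 ≤ Real.log ((k:ℝ) + 1) := Real.log_nonneg (by linarith)
  have hcl := mul_nonneg hc hl
  have hr := hv.rate_nonneg
  unfold bcastProb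
  revert hr
  generalize gstate h = s at hv
  intro hr
  cases s with
  | one l t m =>
    obtain ⟨rfl, h1, h2, -⟩ := hv
    split_ifs
    · refine (min_le_left _ _).trans ?_
      simp only [State.rate] at hr ⊢
      nlinarith
    · refine (min_le_left _ _).trans ?_
      simp only [State.rate] at hr ⊢
      have : Real.log l ≤ Real.log ((k:ℝ) + 1) := by
        refine Real.log_le_log (by linarith) (h2.trans ?_)
        push_cast
        linarith
      have h5 : c * Real.log l / l = c * Real.log l * (1 / l) := by ring
      rw [h5]
      gcongr
      have := mul_le_mul_of_nonneg_left this hc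
      linarith
  | two x =>
    obtain ⟨h1, h2⟩ := hv
    have h1' : (1:ℝ) ≤ x := by exact_mod_cast h1
    have h2' : (x:ℝ) ≤ (h.length / 2 : ℕ) := by exact_mod_cast h2
    split_ifs
    · exact mul_nonneg (by linarith) hr
    · refine (min_le_left _ _).trans ?_
      simp only [State.rate] at hr ⊢
      have : Real.log x ≤ Real.log ((k:ℝ) + 1) := Real.log_le_log (by linarith) (by linarith)
      have h5 : c * Real.log x / x = c * Real.log x * (1 / x) := by ring
      rw [h5]
      gcongr
      have := mul_le_mul_of_nonneg_left this hc
      linarith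

/-! ### Counting broadcasts and active slots -/

/-- The number of slots in which node `i` has broadcast. -/
def attemptCount (i : Fin n) (h : History n) : ℕ := h.countP fun s => i ∈ s.senders

theorem attemptCount_cons (i : Fin n) (s : Slot n) (h : History n) :
    attemptCount i (s :: h) = attemptCount i h + if i ∈ s.senders then 1 else 0 := by
  simp [attemptCount, List.countP_cons]

theorem attemptCount_history {A : Algorithm} {E : Adversary n d} (ω : Coins n) (i : Fin n)
    (T : ℕ) : attemptCount i (history A E ω T) =
      ((Finset.range T).filter fun t => i ∈ (slotAt A E ω t).senders).card := by
  induction T with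
  | zero => rfl
  | succ T ih =>
    rw [history, attemptCount_cons, ih, Finset.range_add_one, Finset.filter_insert]
    change _ + (if i ∈ (slotAt A E ω T).senders then 1 else 0) = _
    split_ifs with hi
    · rw [Finset.card_insert_of_notMem (by simp)]
    · rfl

theorem isActive_history_mono {A : Algorithm} {E : Adversary n d} {ω : Coins n} {i : Fin n}
    {s t : ℕ} (hst : s ≤ t) (h : IsActive (history A E ω t) i) : IsActive (history A E ω s) i := by
  induction t, hst using Nat.le_induction with
  | base => exact h
  | succ t _ ih => exact ih h.tail

theorem activeSlots_subset {A : Algorithm} {E : Adversary n d} {ω : Coins n} {T : ℕ}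
    (h : ∀ i, ¬ IsActive (history A E ω T) i) : activeSlots A E ω ⊆ Finset.range T := by
  rintro t ⟨i, hi⟩
  by_contra hT
  simp only [Finset.coe_range, Set.mem_Iio, not_lt] at hT
  exact h i (isActive_history_mono hT hi)

theorem attempts_subset {A : Algorithm} {E : Adversary n d} {ω : Coins n} {T : ℕ}
    (h : ∀ i, ¬ IsActive (history A E ω T) i) (i : Fin n) :
    attempts A E ω i ⊆ ((Finset.range T).filter fun t => i ∈ (slotAt A E ω t).senders) := by
  intro t ht
  have hact : IsActive (history A E ω t) i := by
    have : i ∈ (slotAt A E ω t).senders := ht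
    simp only [slotAt, nextSlot, Finset.mem_filter] at this
    exact this.2.1
  simp only [Finset.coe_filter, Finset.mem_range]
  refine ⟨?_, ht⟩
  by_contra hT
  exact h i (isActive_history_mono (not_lt.1 hT) hact)

/-- The compensator is twice an upper bound for the sum of the broadcasting probabilities, and it is
bounded on every execution by `totalRate_le`. An inactive node never broadcasts, so an upper bound
for the probability is all that is needed. -/
theorem measure_attemptCount_le {c : ℝ} (hc : 0 ≤ c) (E : Adversary n d) (i : Fin n) (T : ℕ)
    (b : ℝ) :
    coinMeasure n {ω | b ≤ attemptCount i (history (twoPhaseAlgorithm c) E ω T)} ≤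
      ENNReal.ofReal (Real.exp
        (2 * (1 + c * Real.log (T + 1)) * (10 * Real.log (T + 1) + 1) - b)) := by
  set D : ℝ := 1 + c * Real.log (T + 1) with hD
  set W : ℝ := 10 * Real.log (T + 1) + 1 with hW
  have hlT : 0 ≤ Real.log ((T:ℝ) + 1) := Real.log_nonneg (by linarith [Nat.cast_nonneg (α := ℝ) T])
  have hD0 : 0 ≤ D := by positivity
  have hsm := measure_le_of_supermartingale (A := twoPhaseAlgorithm c) (E := E)
    (P := fun _ => True) (Φ := fun h => attemptCount i h - 2 * D * totalRate h)
    (t₁ := 0) (t₂ := T) (a := 0) (b := b - 2 * D * W) (Nat.zero_le _) (fun _ _ _ _ => trivial)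
    (by
      intro h _ hlt _
      simp only [if_true]
      obtain ⟨hp0, hp1⟩ := bcastProb_mem hc h
      set p := bcastProb c h with hp
      have hpr : p ≤ D * (gstate h).rate := bcastProb_le hc h (by omega)
      set r := D * (gstate h).rate with hr
      set φ : ℝ := attemptCount i h - 2 * D * totalRate h with hφ
      have hform : ∀ R b, (attemptCount i (⟨R, b⟩ :: h) : ℝ) - 2 * D * totalRate (⟨R, b⟩ :: h) =
          φ - 2 * r + if i ∈ R then 1 else 0 := by
        intro R b
        rw [attemptCount_cons, totalRate]
        push_cast
        rw [hφ, hr]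
        ring
      have hfinal : (1 - p) * Real.exp (φ - 2 * r) + (1 - (1 - p)) * Real.exp (φ - 2 * r + 1) ≤
          Real.exp φ := by
        have h1 : Real.exp (φ - 2 * r + 1) = Real.exp 1 * Real.exp (φ - 2 * r) := by
          rw [← Real.exp_add]; ring_nf
        have h2 : Real.exp φ = Real.exp (2 * r) * Real.exp (φ - 2 * r) := by
          rw [← Real.exp_add]; ring_nf
        have h3 : Real.exp 1 ≤ 3 := by linarith [Real.exp_one_lt_d9]
        have h4 := Real.add_one_le_exp (2 * r)
        rw [h1, h2]
        -- Since `e ≤ 3`, the left side is at most `1 + 2 * p ≤ 1 + 2 * r`. This is why the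
        -- compensator carries a factor `2`.
        have : (1 - p) + p * Real.exp 1 ≤ Real.exp (2 * r) := by nlinarith
        nlinarith [Real.exp_pos (φ - 2 * r)]
      have hinner : ∀ b, ∫⁻ u : Fin n → I, ENNReal.ofReal (Real.exp
          ((attemptCount i (⟨sendersOf (twoPhaseAlgorithm c) h u, b⟩ :: h) : ℝ) -
            2 * D * totalRate (⟨sendersOf (twoPhaseAlgorithm c) h u, b⟩ :: h))) ≤
          ENNReal.ofReal (Real.exp φ) := by
        intro b
        refine (lintegral_senders_le h (G := fun R => ENNReal.ofReal (Real.exp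
          ((attemptCount i (⟨R, b⟩ :: h) : ℝ) - 2 * D * totalRate (⟨R, b⟩ :: h))))
          (q := 1 - p) (x := Real.exp (φ - 2 * r))
          (y := Real.exp (φ - 2 * r + 1)) {R | i ∉ R} (Real.exp_pos _).le
          (Real.exp_le_exp.2 (by linarith)) ?_ ?_
          (le_volume_notMem_sendersOf i (sendProb_view hc h i))).trans
          (ENNReal.ofReal_le_ofReal hfinal)
        · intro R hR
          simp only [Set.mem_ofPred_eq] at hR
          rw [hform]
          simp [hR]
        · intro R
          rw [hform]
          refine ENNReal.ofReal_le_ofReal (Real.exp_le_exp.2 ?_)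
          split_ifs <;> linarith
      unfold stepInt
      calc _ ≤ ∫⁻ _ : I, ENNReal.ofReal (Real.exp φ) :=
            lintegral_mono fun v => by simp only [nextSlot_eq]; exact hinner _
        _ = _ := by simp)
    (by
      intro h hl _
      have : h = [] := List.length_eq_zero_iff.1 hl
      subst this
      simp [attemptCount, totalRate])
  refine (measure_mono ?_).trans (hsm.trans (le_of_eq ?_))
  · intro ω hω
    simp only [Set.mem_ofPred_eq, true_and] at hω ⊢
    have h1 := totalRate_le (history (twoPhaseAlgorithm c) E ω T)
    rw [length_history] at h1
    have h2 : Real.log ((T / 2 : ℕ) + 1) ≤ Real.log ((T:ℝ) + 1) := by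
      refine Real.log_le_log (by positivity) ?_
      have : ((T / 2 : ℕ) : ℝ) ≤ T := by exact_mod_cast Nat.div_le_self T 2
      linarith
    have h3 : totalRate (history (twoPhaseAlgorithm c) E ω T) ≤ W := by rw [hW]; linarith
    have h4 := mul_le_mul_of_nonneg_left h3 (by positivity : 0 ≤ 2 * D)
    linarith
  · ring_nf

/-! ### Control successes are unlikely while many nodes are active -/

theorem log_le_half {x : ℝ} (hx : 0 < x) : Real.log x ≤ x / 2 := by
  have h1 : Real.log (x / 2) ≤ x / 2 - 1 := Real.log_le_sub_one_of_pos (by positivity)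
  rw [Real.log_div hx.ne' two_ne_zero] at h1
  linarith [Real.log_two_lt_d9]

theorem two_le_div_log {t : ℕ} (ht : 2 ≤ t) : 2 ≤ (t : ℝ) / Real.log t := by
  have h2 : (2:ℝ) ≤ t := by exact_mod_cast ht
  rw [le_div_iff₀ (Real.log_pos (by linarith))]
  linarith [log_le_half (x := t) (by linarith)]

/-- Values of `l` slightly above `1` would be dangerous: `log l` is then small but positive, and a
control success among many nodes could be likely. They do not occur, as `l` is either the integer
`t` or at least `m > t / log t ≥ 2`. -/
theorem State.Valid.eq_one_or_two_le {k : ℕ} {l : ℝ} {t : ℕ} {m : WithTop ℝ}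
    (hs : (State.one l t m).Valid k) : l = 1 ∨ 2 ≤ l := by
  obtain ⟨rfl, h1, h2, ⟨-, h3⟩ | ⟨μ, -, h3, h4, h5⟩⟩ := hs
  · rcases Nat.eq_zero_or_pos k with rfl | hk
    · left; simpa using h3
    · right
      rw [h3]
      have : 2 ≤ k + 1 := by omega
      exact_mod_cast this
  · right
    linarith [two_le_div_log h3]

/-- If `l = 1` nobody broadcasts, and if the probability is truncated at `1` at least two nodes
collide. Otherwise `log x / x` is essentially decreasing, so `l < N` gives `N * p ≥ (c / 2) * log
N`, and a lone broadcaster has probability at most `N ^ (1 - c / 4)`. -/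
theorem control_success_le {N : ℕ} {l g c : ℝ} (hl : l = 1 ∨ 2 ≤ l) (hg : 4 ≤ g)
    (hN : max l g < N) (hc : 4 ≤ c) :
    N * (min (c * Real.log l / l) 1 * (1 - min (c * Real.log l / l) 1) ^ (N - 1)) ≤
      Real.exp (-((c / 4 - 1) * Real.log g)) := by
  have hlN : l < N := (le_max_left _ _).trans_lt hN
  have hgN : g < N := (le_max_right _ _).trans_lt hN
  have hN2 : 2 ≤ N := by
    have : (2:ℝ) < N := by linarith
    exact_mod_cast this.le
  rcases hl with rfl | hl
  · simp [(Real.exp_pos _).le]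
  have hlogl : 0 ≤ Real.log l := Real.log_nonneg (by linarith)
  rcases le_total 1 (c * Real.log l / l) with h1 | h1
  · rw [min_eq_right h1, sub_self, zero_pow (by omega)]
    simp [(Real.exp_pos _).le]
  rw [min_eq_left h1]
  set p := c * Real.log l / l with hp
  have hp0 : 0 ≤ p := by positivity
  have hNpos : (0:ℝ) < N := by linarith
  have hexp4 : Real.exp 1 ≤ 4 := by linarith [Real.exp_one_lt_d9]
  -- `log x / x` decreases only beyond `e`; the factor `1 / 2` makes room for `2 ≤ l ≤ e`.
  have hkey : Real.log N / N / 2 ≤ Real.log l / l := by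
    rcases le_total (Real.exp 1) l with he | he
    · have h2 := Real.log_div_self_antitoneOn (Set.mem_Ici.2 he) (Set.mem_Ici.2 (he.trans hlN.le))
        hlN.le
      simp only at h2
      have : 0 ≤ Real.log N / N := div_nonneg (Real.log_natCast_nonneg _) hNpos.le
      linarith
    · have h2 := Real.log_div_self_antitoneOn (Set.mem_Ici.2 hexp4)
        (Set.mem_Ici.2 (hexp4.trans (hg.trans hgN.le))) (hg.trans hgN.le)
      simp only at h2
      have h3 : Real.log 4 = 2 * Real.log 2 := by
        rw [show (4:ℝ) = 2 ^ 2 by norm_num, Real.log_pow]; push_cast; ring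
      have h4 : Real.log 2 ≤ Real.log l := Real.log_le_log (by norm_num) hl
      have h5 : Real.log 2 / 4 ≤ Real.log l / l := by
        rw [div_le_div_iff₀ (by norm_num) (by linarith)]
        have : 0 < Real.log 2 := Real.log_pos (by norm_num)
        nlinarith
      rw [h3] at h2
      linarith
  have h3 : c / 2 * Real.log N ≤ N * p := by
    have h4 : p = c * (Real.log l / l) := by rw [hp]; ring
    have h5 : c / 2 * Real.log N = N * (c * (Real.log N / N / 2)) := by field_simp
    rw [h4, h5]
    gcongr
  have h6 := one_sub_pow_le_exp h1 hp0 hN2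
  have hlogN : Real.log g ≤ Real.log N := Real.log_le_log (by linarith) hgN.le
  calc N * (p * (1 - p) ^ (N - 1)) ≤ N * (1 * Real.exp (-(N * p / 2))) := by
        gcongr
    _ ≤ Real.exp (Real.log N) * Real.exp (-(c / 4 * Real.log N)) := by
        rw [Real.exp_log hNpos, one_mul]
        gcongr
        linarith
    _ = Real.exp (-((c / 4 - 1) * Real.log N)) := by rw [← Real.exp_add]; ring_nf
    _ ≤ _ := by
        refine Real.exp_le_exp.2 (neg_le_neg ?_)
        gcongr
        linarith

/-- The number `N` of active nodes is controlled by the state: in phase one by the variable `m`,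
in phase two by `G`. -/
def State.Inv (g G N : ℝ) : State → Prop
  | .one _ _ ⊤ => True
  | .one _ _ (WithTop.some μ) => N ≤ max (2 * μ) g
  | .two _ => N ≤ G

/-- A success with `N ≤ max l g` records an `m` with `l ≤ 2 * m`, which keeps the invariant. When
phase two starts, `m ≤ t / log t` turns it into `N ≤ G`. -/
theorem State.Inv.update {g G N N' : ℝ} {k T : ℕ} {s : State} (hgG : g ≤ G)
    (hG : ∀ t : ℕ, 2 ≤ t → t ≤ T + 1 → 2 * ((t : ℝ) / Real.log t) ≤ G)
    (hv : s.Valid k) (hk : k < T) (hs : s.Inv g G N) (hN : N' ≤ N) {b : Bool}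
    (hb : b = true → ∀ l t m, s = .one l t m → N ≤ max l g) : (s.update b).Inv g G N' := by
  cases s with
  | two x => exact hN.trans hs
  | one l t m =>
    obtain ⟨rfl, h1, h2, h3⟩ := hv
    have haux : ∀ μ' l' : ℝ, N ≤ max (2 * μ') g →
        (if μ' ≤ ((k + 1 + 1 : ℕ) : ℝ) / Real.log ((k + 1 + 1 : ℕ) : ℝ) then State.two 1
          else .one l' (k + 1 + 1) μ').Inv g G N' := by
      intro μ' l' hμ
      split_ifs with hc
      · refine hN.trans (hμ.trans (max_le ?_ hgG))
        exact (by linarith : 2 * μ' ≤ _).trans (hG (k + 1 + 1) (by omega) (by omega))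
      · exact hN.trans hμ
    have hmax : l ≤ 2 * max (l / 2) 1 := by linarith [le_max_left (l / 2) 1]
    rcases h3 with ⟨rfl, h3⟩ | ⟨μ, rfl, h3, h4, h5⟩
    · cases b with
      | false => rw [State.update_one_false_top]; trivial
      | true =>
        rw [State.update_one_true_top]
        refine haux _ _ ((hb rfl _ _ _ rfl).trans (max_le_max_right _ hmax))
    · have hs' : N ≤ max (2 * μ) g := hs
      cases b with
      | false => rw [State.update_one_false_coe]; exact haux _ _ hs'
      | true =>
        rw [State.update_one_true_coe]
        refine haux _ _ ?_
        rcases min_choice μ (max (l / 2) 1) with hm | hm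
        · rw [hm]; exact hs'
        · rw [hm]; exact (hb rfl _ _ _ rfl).trans (max_le_max_right _ hmax)

/-- At all times so far the number of active nodes was controlled by the state. -/
def Controlled (g G : ℝ) (h : History n) : Prop :=
  ∀ h' : History n, h' <:+ h → (gstate h').Inv g G (numActive h')

theorem Controlled.inv {g G : ℝ} {h : History n} (hh : Controlled g G h) :
    (gstate h).Inv g G (numActive h) := hh h (List.suffix_refl h)

theorem Controlled.tail {g G : ℝ} {s : Slot n} {h : History n} (hh : Controlled g G (s :: h)) :
    Controlled g G h := fun h' hh' => hh h' (hh'.trans (List.suffix_cons s h))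

theorem Controlled.cons {g G : ℝ} {s : Slot n} {h : History n} (hh : Controlled g G h)
    (hs : (gstate (s :: h)).Inv g G (numActive (s :: h))) : Controlled g G (s :: h) := by
  intro h' hh'
  rcases List.suffix_cons_iff.1 hh' with rfl | hh'
  · exact hs
  · exact hh h' hh'

open Classical in
theorem Controlled.cons_of_hasSuccess {g G : ℝ} {T : ℕ} {s : Slot n} {h : History n}
    (hgG : g ≤ G) (hG : ∀ t : ℕ, 2 ≤ t → t ≤ T + 1 → 2 * ((t : ℝ) / Real.log t) ≤ G)
    (hh : Controlled g G h) (hlen : h.length < 2 * T)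
    (hs : Odd h.length → s.HasSuccess → ∀ l t m, gstate h = .one l t m →
      numActive h ≤ max l g) : Controlled g G (s :: h) := by
  refine hh.cons ?_
  have hN : (numActive (s :: h) : ℝ) ≤ numActive h := by exact_mod_cast numActive_cons_le s h
  rw [gstate_cons]
  split_ifs with ho
  · refine State.Inv.update hgG hG (gstate_valid h) (by omega) hh.inv hN ?_
    intro hb
    exact hs ho (by simpa using hb)
  · have := hh.inv
    revert this
    generalize gstate h = st
    intro this
    match st with
    | .one _ _ ⊤ => trivial
    | .one _ _ (WithTop.some μ) => exact hN.trans this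
    | .two _ => exact hN.trans this

theorem measure_not_controlled_le {c g G : ℝ} (hc : 4 ≤ c) (hg : 4 ≤ g) (hgG : g ≤ G) (T : ℕ)
    (hG : ∀ t : ℕ, 2 ≤ t → t ≤ T + 1 → 2 * ((t : ℝ) / Real.log t) ≤ G) (E : Adversary n d) :
    coinMeasure n {ω | ¬ Controlled g G (history (twoPhaseAlgorithm c) E ω (2 * T))} ≤
      ENNReal.ofReal ((2 * T : ℕ) * Real.exp (-((c / 4 - 1) * Real.log g))) := by
  have hc0 : 0 ≤ c := by linarith
  refine measure_not_le_of_step (Real.exp_pos _).le ?_ ?_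
  · intro h' hh'
    rw [List.suffix_nil.1 hh']
    trivial
  intro h hlen hh
  calc _ ≤ ∫⁻ _ : I, ENNReal.ofReal (Real.exp (-((c / 4 - 1) * Real.log g))) := by
        refine lintegral_mono fun v => ?_
        by_cases hex : Odd h.length ∧ ∃ l t m, gstate h = .one l t m ∧ max l g < numActive h
        · obtain ⟨ho, l, t, m, hst, hN⟩ := hex
          have hv := gstate_valid h
          rw [hst] at hv
          have hpr : bcastProb c h = min (c * Real.log l / l) 1 := by
            rw [bcastProb, if_neg (Nat.not_even_iff_odd.2 ho), hst, State.controlProb]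
          have h1 := volume_hasSuccess_le (E := E) (sendProb_view hc0 h) v
          have h2 := control_success_le hv.eq_one_or_two_le hg hN hc
          rw [← hpr] at h2
          refine (measure_mono ?_).trans (h1.trans (ENNReal.ofReal_le_ofReal h2))
          intro u hu
          by_contra hns
          exact hu (hh.cons_of_hasSuccess hgG hG hlen fun _ hsucc => absurd hsucc hns)
        · refine (le_of_eq ?_).trans zero_le
          have hemp : {u | ¬ Controlled g G (nextSlot (twoPhaseAlgorithm c) E h v u :: h)} = ∅ := by
            refine Set.eq_empty_of_forall_notMem fun u hu => hu ?_
            refine hh.cons_of_hasSuccess hgG hG hlen fun ho _ l t m hst => ?_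
            by_contra hlt
            exact hex ⟨ho, l, t, m, hst, not_le.1 hlt⟩
          rw [hemp, measure_empty]
    _ = _ := by simp

/-! ### Phase one ends in time -/

theorem jamCount_cons (s : Slot n) (h : History n) :
    jamCount (s :: h) = jamCount h + if s.jammed then 1 else 0 := by
  simp [jamCount, List.countP_cons]

theorem jamCount_history_le {A : Algorithm} {E : Adversary n d} (ω : Coins n) (t : ℕ) :
    jamCount (history A E ω t) ≤ d := by
  induction t with
  | zero => exact Nat.zero_le _
  | succ t ih =>
    rw [history, jamCount_cons]
    rcases ih.lt_or_eq with hlt | heq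
    · split_ifs <;> omega
    · have : E.jamProb (history A E ω t) = 0 := E.budget _ heq.ge
      simp [nextSlot, this, heq]

/-- The state belongs to phase one. -/
def State.IsOne : State → Prop
  | .one _ _ _ => True
  | .two _ => False

/-- The variable `l` of phase one. -/
def State.ell : State → ℝ
  | .one l _ _ => l
  | .two _ => 0

theorem State.isOne_of_update {s : State} {b : Bool} (h : (s.update b).IsOne) : s.IsOne := by
  cases s with
  | one l t m => trivial
  | two x => exact h

theorem State.ell_update {s : State} {b : Bool} (h : (s.update b).IsOne) :
    (s.update b).ell = if b then max (s.ell / 2) 1 else s.ell + 1 := by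
  cases s with
  | two x => exact absurd h id
  | one l t m =>
    revert h
    unfold State.update
    simp only
    split_ifs
    · intro h; exact absurd h id
    · intro; rfl
    · intro h; exact absurd h id
    · intro; rfl

theorem Slot.hasSuccess_singleton (i : Fin n) : (⟨{i}, false⟩ : Slot n).HasSuccess :=
  ⟨i, rfl, rfl⟩

/-- The execution is still in phase one, and was always controlled. -/
def InPhaseOne (g G : ℝ) (h : History n) : Prop :=
  Controlled g G h ∧ 1 ≤ numActive h ∧ (gstate h).IsOne

theorem InPhaseOne.tail {g G : ℝ} {s : Slot n} {h : History n} (hh : InPhaseOne g G (s :: h)) :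
    InPhaseOne g G h := by
  refine ⟨hh.1.tail, hh.2.1.trans (numActive_cons_le s h), ?_⟩
  have := hh.2.2
  rw [gstate_cons] at this
  split_ifs at this
  · exact State.isOne_of_update this
  · exact this

/-- Either `l = t` is still larger than `M ≥ n`, or `l ≥ m > t / log t ≥ g` and control gives `N ≤
max (2 * m) g`. The first `M` rounds are sacrificed to make this true. -/
theorem InPhaseOne.bounds {g G : ℝ} {M : ℕ} {h : History n} (hh : InPhaseOne g G h)
    (hn : n ≤ M) (hgM : g ≤ M) (hg : ∀ t : ℕ, M ≤ t → g ≤ (t : ℝ) / Real.log t)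
    (hlen : 2 * M ≤ h.length) :
    g ≤ (gstate h).ell ∧ (numActive h : ℝ) ≤ 2 * (gstate h).ell := by
  have hv := gstate_valid h
  have hinv := hh.1.inv
  have hone := hh.2.2
  revert hv hinv hone
  generalize gstate h = s
  intro hv hinv hone
  cases s with
  | two x => exact absurd hone id
  | one l t m =>
    obtain ⟨rfl, h1, h2, h3⟩ := hv
    have hMk : M ≤ h.length / 2 := by omega
    have hMk' : (M:ℝ) ≤ (h.length / 2 : ℕ) := by exact_mod_cast hMk
    simp only [State.ell]
    rcases h3 with ⟨rfl, h3⟩ | ⟨μ, rfl, h3, h4, h5⟩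
    · have hNn : (numActive h : ℝ) ≤ M := by exact_mod_cast (numActive_le h).trans hn
      push_cast at h3
      constructor <;> linarith
    · have hgl : g ≤ l := ((hg _ (by omega)).trans h5.le).trans h4
      refine ⟨hgl, ?_⟩
      have : (numActive h : ℝ) ≤ max (2 * μ) g := hinv
      exact this.trans (max_le (by linarith) (by linarith))

open Classical in
/-- The potential of phase one: time, `l`, active nodes, remaining jams, and a credit between the
data and the control slot of a round in which `l` is small. -/
def onePotential (lam A b : ℝ) (h : History n) : ℝ :=
  lam * ((h.length / 2 : ℕ) + (gstate h).ell + b * numActive h - 2 * jamCount h +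
    if Odd h.length ∧ (gstate h).ell < A * numActive h then 2 else 0)

theorem onePotential_even {lam A b : ℝ} {h : History n} (he : Even h.length) :
    onePotential lam A b h =
      lam * ((h.length / 2 : ℕ) + (gstate h).ell + b * numActive h - 2 * jamCount h) := by
  rw [onePotential, if_neg (fun hh => Nat.not_even_iff_odd.2 hh.1 he), add_zero]

/-- Lower bound for the probability of a success in an unjammed control slot when `l` is large
compared with the number `N` of active nodes. -/
theorem le_success_prob_control {c A l : ℝ} {N : ℕ} (hc : 0 < c) (hA : 4 * c ≤ A) (hl : 1 < l)
    (hN : 1 ≤ N) (hNl : A * N ≤ l) (hp : c * Real.log l / l ≤ 1 / 2)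
    (hlarge : c * Real.exp (-2) * Real.log l / l ≤ Real.exp (-(Real.log l / 2))) :
    c * Real.exp (-2) * Real.log l / l ≤
      N * (c * Real.log l / l * (1 - c * Real.log l / l) ^ (N - 1)) := by
  have hlog : 0 < Real.log l := Real.log_pos hl
  set p := c * Real.log l / l with hpdef
  have hp0 : 0 < p := by positivity
  have h1 := exp_le_one_sub_pow hp0.le hp N
  have hN' : (1:ℝ) ≤ N := by exact_mod_cast hN
  have h2 : N * (p * Real.exp (-(2 * (N * p)))) ≤ N * (p * (1 - p) ^ (N - 1)) := by gcongr
  refine le_trans ?_ h2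
  -- With load `N * p` at most `1`, silence of the others costs only `exp (-2)`. With a larger load,
  -- `N ≤ l / (4 * c)` still gives `N * p ≤ log l / 4`, so the success probability is at least `1 /
  -- √l`, more than needed by `hlarge`.
  rcases le_total (N * p) 1 with h3 | h3
  · calc c * Real.exp (-2) * Real.log l / l = 1 * (p * Real.exp (-2)) := by rw [hpdef]; ring
      _ ≤ N * (p * Real.exp (-(2 * (N * p)))) := by
        gcongr
        linarith
  · have h4 : N * p ≤ Real.log l / 4 := by
      have h5 : 4 * c * N ≤ l := by nlinarith
      rw [hpdef, mul_div_assoc', div_le_div_iff₀ (by linarith) (by norm_num)]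
      nlinarith
    calc c * Real.exp (-2) * Real.log l / l ≤ Real.exp (-(Real.log l / 2)) := hlarge
      _ ≤ 1 * Real.exp (-(2 * (N * p))) := by
        rw [one_mul]; exact Real.exp_le_exp.2 (by linarith)
      _ ≤ N * p * Real.exp (-(2 * (N * p))) := by gcongr
      _ = _ := by ring

/-- The load `N / l` lies between `1 / A` and `2`, so the success probability is bounded below by a
constant. -/
theorem le_success_prob_data {A l : ℝ} {N : ℕ} (hl : 2 ≤ l) (hA : 0 < A)
    (hN1 : l < A * N) (hN2 : N ≤ 2 * l) :
    Real.exp (-4) / A ≤ N * (1 / l * (1 - 1 / l) ^ (N - 1)) := by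
  have hl0 : 0 < l := by linarith
  have h1 := exp_le_one_sub_pow (p := 1 / l) (by positivity)
    (by rw [div_le_div_iff₀ hl0 (by norm_num)]; linarith) N
  have h2 : N * (1 / l) ≤ 2 := by rw [mul_one_div, div_le_iff₀ hl0]; linarith
  have h3 : 1 / A ≤ N * (1 / l) := by
    rw [mul_one_div, div_le_div_iff₀ hA hl0]; linarith
  calc Real.exp (-4) / A = 1 / A * Real.exp (-4) := by ring
    _ ≤ N * (1 / l) * Real.exp (-(2 * (N * (1 / l)))) := by
      gcongr
      linarith
    _ ≤ N * (1 / l) * (1 - 1 / l) ^ (N - 1) := by gcongr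
    _ = _ := by ring

/-- After `M` rounds the potential is at most `lam * (2 * M + 1 + b * M)`, whereas being in phase
one after `T` rounds forces it to be at least `lam * (T - 2 * d)`. `hdata` and `hcontrol` state that
the two kinds of useful slots compensate an increase of `2`. -/
theorem measure_inPhaseOne_le {c g G A b lam : ℝ} {M T : ℕ} (hc : 0 < c) (hA : 4 * c ≤ A)
    (hb : 0 ≤ b) (hlam : 0 < lam) (hg4 : 4 ≤ g) (hn : n ≤ M) (hMT : M ≤ T) (hgM : g ≤ M)
    (hg : ∀ t : ℕ, M ≤ t → g ≤ (t : ℝ) / Real.log t)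
    (hp : ∀ l, g ≤ l → c * Real.log l / l ≤ 1 / 2)
    (hlarge : ∀ l, g ≤ l → c * Real.exp (-2) * Real.log l / l ≤ Real.exp (-(Real.log l / 2)))
    (hdata : Real.exp (-4) / A * Real.exp (lam * (2 - b)) +
      (1 - Real.exp (-4) / A) * Real.exp (lam * 2) ≤ 1)
    (hcontrol : ∀ l, g ≤ l → l ≤ T + 1 →
      c * Real.exp (-2) * Real.log l / l * Real.exp (lam * (1 - l / 2)) +
        (1 - c * Real.exp (-2) * Real.log l / l) * Real.exp (lam * 2) ≤ 1)
    (E : Adversary n d) :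
    coinMeasure n {ω | InPhaseOne g G (history (twoPhaseAlgorithm c) E ω (2 * T))} ≤
      ENNReal.ofReal (Real.exp (lam * (2 * M + 1 + b * M + 2 * d - T))) := by
  classical
  have hA0 : 0 < A := by linarith
  have hsm := measure_le_of_supermartingale (A := twoPhaseAlgorithm c) (E := E)
    (P := InPhaseOne g G) (Φ := onePotential lam A b)
    (t₁ := 2 * M) (t₂ := 2 * T) (a := lam * (2 * M + 1 + b * M)) (b := lam * (T - 2 * d))
    (by omega) (fun _ _ _ hh => hh.tail) ?_ ?_
  · refine (measure_mono ?_).trans (hsm.trans (le_of_eq ?_))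
    · intro ω hω
      refine ⟨hω, ?_⟩
      have hj : (jamCount (history (twoPhaseAlgorithm c) E ω (2 * T)) : ℝ) ≤ d := by
        exact_mod_cast jamCount_history_le ω (2 * T)
      rw [onePotential_even (by rw [length_history]; simp), length_history]
      have hell : 0 ≤ (gstate (history (twoPhaseAlgorithm c) E ω (2 * T))).ell := by
        have hb := (hω.bounds hn hgM hg (by rw [length_history]; omega)).1
        linarith
      have hN : 0 ≤ b * (numActive (history (twoPhaseAlgorithm c) E ω (2 * T)) : ℝ) := by positivity
      have : (2 * T / 2 : ℕ) = T := by omega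
      rw [this]
      gcongr
      linarith
    · ring_nf
  · intro h hlen1 hlen2 hh
    obtain ⟨hgl, hNl⟩ := hh.bounds hn hgM hg hlen1
    have hN1 := hh.2.1
    have hv := gstate_valid h
    obtain ⟨l, t, m, hst⟩ : ∃ l t m, gstate h = .one l t m := by
      have := hh.2.2
      match hs : gstate h with
      | .one l t m => exact ⟨l, t, m, rfl⟩
      | .two x => rw [hs] at this; exact absurd this id
    rw [hst] at hgl hNl hv
    simp only [State.ell] at hgl hNl
    have hlT : l ≤ T + 1 := by
      have h1 := hv.2.2.1
      have h2 := hv.1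
      have h3 : t ≤ T + 1 := by omega
      have h4 : (t:ℝ) ≤ T + 1 := by exact_mod_cast h3
      linarith
    have hl4 : 4 ≤ l := by linarith
    have hl0 : 0 < l := by linarith
    set φ := onePotential lam A b h with hφ
    have hite : ∀ (s : Slot n) (z : ℝ),
        (InPhaseOne g G (s :: h) → onePotential lam A b (s :: h) ≤ φ + z) →
        (if InPhaseOne g G (s :: h) then
          ENNReal.ofReal (Real.exp (onePotential lam A b (s :: h))) else 0) ≤
          ENNReal.ofReal (Real.exp (φ + z)) := by
      intro s z hz
      split_ifs with hP
      · exact ENNReal.ofReal_le_ofReal (Real.exp_le_exp.2 (hz hP))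
      · exact zero_le
    have hscale : ∀ q z1 z2 : ℝ, q * Real.exp z1 + (1 - q) * Real.exp z2 ≤ 1 →
        q * Real.exp (φ + z1) + (1 - q) * Real.exp (φ + z2) ≤ Real.exp φ := by
      intro q z1 z2 hq
      rw [Real.exp_add, Real.exp_add]
      nlinarith [Real.exp_pos φ]
    have hvol := volume_sendersOf_singleton (sendProb_view hc.le h)
    simp only at hvol
    have hNle : ∀ s : Slot n, b * (numActive (s :: h) : ℝ) ≤ b * numActive h := fun s => by
      have : (numActive (s :: h) : ℝ) ≤ numActive h := by exact_mod_cast numActive_cons_le s h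
      gcongr
    have hjle : ∀ s : Slot n, (jamCount h : ℝ) ≤ jamCount (s :: h) := fun s => by
      rw [jamCount_cons]; push_cast; split_ifs <;> simp
    have hjeq : ∀ R, (jamCount (⟨R, true⟩ :: h) : ℝ) = jamCount h + 1 := fun R => by
      rw [jamCount_cons]; simp
    rcases Nat.even_or_odd h.length with he | ho
    · have ho' : ∀ s : Slot n, Odd (s :: h).length := fun s => by simpa using he.add_one
      have hk : ∀ s : Slot n, (s :: h).length / 2 = h.length / 2 := fun s => by
        obtain ⟨k, hk⟩ := he
        simp only [List.length_cons]
        omega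
      have hφ' : φ = lam * ((h.length / 2 : ℕ) + l + b * numActive h - 2 * jamCount h) := by
        rw [hφ, onePotential_even he, hst, State.ell]
      -- Data slot with small `l`: the credit of `2` is deposited, and is compensated by a success
      -- (minus `b`) or by a jam (minus `2`).
      by_cases hcase : l < A * numActive h
      · have hform : ∀ s : Slot n, onePotential lam A b (s :: h) ≤
            lam * ((h.length / 2 : ℕ) + l + b * numActive (s :: h) - 2 * jamCount (s :: h) + 2) := by
          intro s
          rw [onePotential, hk, gstate_cons_even he, hst, State.ell]
          gcongr
          split_ifs <;> norm_num
        refine stepInt_le h {R | ∃ i ∈ activeSet h, R = {i}} (Real.exp_pos (φ + lam * (2 - b))).le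
          (y := Real.exp (φ + lam * 2)) (q := Real.exp (-4) / A) (Real.exp_le_exp.2 ?_)
          ?_ ?_ ?_ ?_ (hscale _ _ _ hdata)
        · gcongr; linarith
        · intro R
          have := hite ⟨R, true⟩ 0 (fun _ => by
            refine (hform _).trans ?_
            rw [hjeq, hφ', add_zero]
            refine mul_le_mul_of_nonneg_left ?_ hlam.le
            linarith [hNle ⟨R, true⟩])
          simpa using this
        · rintro R ⟨i, hi, rfl⟩
          refine hite _ _ fun _ => (hform _).trans ?_
          have h1 : (numActive (⟨{i}, false⟩ :: h) : ℝ) + 1 ≤ numActive h := by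
            exact_mod_cast numActive_cons_singleton hi
          have h2 := mul_le_mul_of_nonneg_left h1 hb
          rw [hφ', ← mul_add]
          refine mul_le_mul_of_nonneg_left ?_ hlam.le
          linarith [hjle ⟨{i}, false⟩]
        · intro R
          refine hite _ _ fun _ => (hform _).trans ?_
          rw [hφ', ← mul_add]
          refine mul_le_mul_of_nonneg_left ?_ hlam.le
          linarith [hjle ⟨R, false⟩, hNle ⟨R, false⟩]
        · have hpr : bcastProb c h = 1 / l := by
            rw [bcastProb, if_pos he, hst, State.dataProb, min_eq_left]
            rw [div_le_one hl0]
            linarith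
          simp only [Set.mem_ofPred_eq]
          rw [hvol, hpr]
          exact ENNReal.ofReal_le_ofReal (le_success_prob_data (by linarith) hA0 hcase hNl)
      -- Data slot with large `l`: no credit is created, since `numActive` can only drop and `l`
      -- does not move. The potential cannot increase.
      · refine stepInt_le_of_forall fun s => ?_
        have := hite s 0 (fun _ => by
          rw [onePotential, hk, gstate_cons_even he, hst, State.ell, if_neg, hφ', add_zero, add_zero]
          · refine mul_le_mul_of_nonneg_left ?_ hlam.le
            linarith [hjle s, hNle s]
          · rintro ⟨-, hlt⟩
            refine hcase (hlt.trans_le ?_)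
            have : (numActive (s :: h) : ℝ) ≤ numActive h := by
              exact_mod_cast numActive_cons_le s h
            gcongr)
        simpa using this
    · have he' : ∀ s : Slot n, Even (s :: h).length := fun s => by simpa using ho.add_one
      have hk : ∀ s : Slot n, (s :: h).length / 2 = h.length / 2 + 1 := fun s => by
        obtain ⟨k, hk⟩ := ho
        simp only [List.length_cons]
        omega
      have hell : ∀ s : Slot n, InPhaseOne g G (s :: h) → (gstate (s :: h)).ell =
          if s.HasSuccess then max (l / 2) 1 else l + 1 := by
        intro s hs
        have h1 := hs.2.2
        rw [gstate_cons, if_pos ho] at h1 ⊢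
        rw [State.ell_update h1, hst, State.ell]
        by_cases hsucc : s.HasSuccess <;> simp [hsucc]
      have hell' : ∀ s : Slot n, InPhaseOne g G (s :: h) → (gstate (s :: h)).ell ≤ l + 1 := by
        intro s hs
        rw [hell s hs]
        split_ifs
        · exact max_le (by linarith) (by linarith)
        · exact le_rfl
      have hφ' : φ = lam * ((h.length / 2 : ℕ) + l + b * numActive h - 2 * jamCount h +
          if l < A * numActive h then 2 else 0) := by
        rw [hφ, onePotential, hst, State.ell]
        simp only [ho, true_and]
      -- Control slot: time and `l` grow by at most `1` each. For small `l` the credit from the data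
      -- slot pays for this with certainty; for large `l` a success halves `l`, or a jam pays.
      by_cases hcase : l < A * numActive h
      · rw [if_pos hcase] at hφ'
        refine stepInt_le_of_forall fun s => ?_
        have := hite s 0 (fun hs => by
          rw [onePotential_even (he' s), hk, hφ', add_zero]
          push_cast
          refine mul_le_mul_of_nonneg_left ?_ hlam.le
          linarith [hjle s, hNle s, hell' s hs])
        simpa using this
      · rw [if_neg hcase, add_zero] at hφ'
        refine stepInt_le h {R | ∃ i ∈ activeSet h, R = {i}}
          (Real.exp_pos (φ + lam * (1 - l / 2))).le
          (y := Real.exp (φ + lam * 2)) (q := c * Real.exp (-2) * Real.log l / l)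
          (Real.exp_le_exp.2 ?_) ?_ ?_ ?_ ?_ (hscale _ _ _ (hcontrol l hgl hlT))
        · gcongr; linarith
        · intro R
          have := hite ⟨R, true⟩ 0 (fun hs => by
            rw [onePotential_even (he' _), hk, hφ', add_zero, hjeq]
            push_cast
            refine mul_le_mul_of_nonneg_left ?_ hlam.le
            linarith [hNle ⟨R, true⟩, hell' _ hs])
          simpa using this
        · rintro R ⟨i, hi, rfl⟩
          refine hite _ _ fun hs => ?_
          have h1 := hell _ hs
          rw [if_pos (Slot.hasSuccess_singleton i), max_eq_left (by linarith)] at h1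
          rw [onePotential_even (he' _), hk, hφ', ← mul_add, h1]
          push_cast
          refine mul_le_mul_of_nonneg_left ?_ hlam.le
          linarith [hjle ⟨{i}, false⟩, hNle ⟨{i}, false⟩]
        · intro R
          refine hite _ _ fun hs => ?_
          rw [onePotential_even (he' _), hk, hφ', ← mul_add]
          push_cast
          refine mul_le_mul_of_nonneg_left ?_ hlam.le
          linarith [hjle ⟨R, false⟩, hNle ⟨R, false⟩, hell' _ hs]
        · have hpr : bcastProb c h = c * Real.log l / l := by
            rw [bcastProb, if_neg (Nat.not_even_iff_odd.2 ho), hst, State.controlProb, min_eq_left]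
            linarith [hp l hgl]
          simp only [Set.mem_ofPred_eq]
          rw [hvol, hpr]
          exact ENNReal.ofReal_le_ofReal (le_success_prob_control hc hA (by linarith) hN1
            (not_lt.1 hcase) (hp l hgl) (hlarge l hgl))
  · intro h hlen hh
    have hN : (numActive h : ℝ) ≤ M := by exact_mod_cast (numActive_le h).trans hn
    have hell : (gstate h).ell ≤ M + 1 := by
      have hv := gstate_valid h
      revert hv
      generalize gstate h = s
      intro hv
      cases s with
      | two x => simp only [State.ell]; positivity
      | one l t m =>
        obtain ⟨rfl, h1, h2, h3⟩ := hv
        have : h.length / 2 = M := by omega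
        rw [this] at h2
        push_cast at h2
        exact h2
    have hM : h.length / 2 = M := by omega
    rw [onePotential_even (by rw [hlen]; simp), hM]
    have hj : (0:ℝ) ≤ jamCount h := Nat.cast_nonneg _
    have := mul_le_mul_of_nonneg_left hN hb
    gcongr
    linarith

/-! ### Phase two serves the remaining nodes -/

/-- Phase two is never left, and its counter advances once per round whatever the feedback is. -/
theorem gstate_of_suffix {h h' : History n} {x : ℕ} (hs : h' <:+ h) (he : Even h'.length)
    (hst : gstate h' = .two x) : gstate h = .two (x + (h.length / 2 - h'.length / 2)) := by
  induction h with
  | nil =>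
    rw [List.suffix_nil.1 hs] at hst ⊢
    simpa using hst
  | cons s h ih =>
    rcases List.suffix_cons_iff.1 hs with rfl | hs'
    · simpa using hst
    · have hle := hs'.length_le
      rw [gstate_cons, ih hs']
      split_ifs with ho
      · have : (s :: h).length / 2 = h.length / 2 + 1 := by
          obtain ⟨k, hk⟩ := ho
          simp only [List.length_cons]
          omega
        rw [this, State.update]
        congr 1
        omega
      · have : (s :: h).length / 2 = h.length / 2 := by
          obtain ⟨k, hk⟩ := Nat.not_odd_iff_even.1 ho
          simp only [List.length_cons]
          omega
        rw [this]

theorem numActive_le_of_suffix {h h' : History n} (hs : h' <:+ h) :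
    numActive h ≤ numActive h' := by
  induction h with
  | nil => rw [List.suffix_nil.1 hs]
  | cons s h ih =>
    rcases List.suffix_cons_iff.1 hs with rfl | hs'
    · exact le_rfl
    · exact (numActive_cons_le s h).trans (ih hs')

/-- Node `i` is active, and after `T` rounds the execution was in phase two with at most `G`
active nodes. -/
def WaitsInPhaseTwo (T : ℕ) (G : ℝ) (i : Fin n) (h : History n) : Prop :=
  IsActive h i ∧ ∃ h' : History n, h' <:+ h ∧ h'.length = 2 * T ∧ (numActive h' : ℝ) ≤ G ∧
    ∃ x, gstate h' = .two x

theorem WaitsInPhaseTwo.tail {T : ℕ} {G : ℝ} {i : Fin n} {s : Slot n} {h : History n}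
    (hlen : 2 * T ≤ h.length) (hh : WaitsInPhaseTwo T G i (s :: h)) : WaitsInPhaseTwo T G i h := by
  obtain ⟨h1, h', h2, h3, h4⟩ := hh
  refine ⟨h1.tail, h', ?_, h3, h4⟩
  rcases List.suffix_cons_iff.1 h2 with rfl | h2
  · simp only [List.length_cons] at h3
    omega
  · exact h2

/-- The first `L` rounds only raise `x` to at least `L`, where the load `p * G` is at most `1`. In
each of the next `L` rounds an unjammed control slot frees node `i` with probability at least `q`,
and at most `d` of them are jammed. -/
theorem measure_waitsInPhaseTwo_le {c q G : ℝ} {T L : ℕ} (hc : 0 ≤ c) (hq : 0 ≤ q)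
    (hp : ∀ x : ℕ, L ≤ x → x ≤ T + 2 * L → c * Real.log x / x ≤ 1 / 2 ∧
      c * Real.log x / x * G ≤ 1 ∧ q ≤ c * Real.log x / x * Real.exp (-2))
    (E : Adversary n d) (i : Fin n) :
    coinMeasure n {ω | WaitsInPhaseTwo T G i
        (history (twoPhaseAlgorithm c) E ω (2 * (T + 2 * L)))} ≤
      ENNReal.ofReal (Real.exp (q * (d - L))) := by
  classical
  have hsm := measure_le_of_supermartingale (A := twoPhaseAlgorithm c) (E := E)
    (P := WaitsInPhaseTwo T G i) (Φ := fun h => q * ((h.length / 2 : ℕ) - jamCount h))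
    (t₁ := 2 * (T + L)) (t₂ := 2 * (T + 2 * L)) (a := q * (T + L)) (b := q * (T + 2 * L - d))
    (by omega) (fun _ _ hl hh => hh.tail (by omega)) ?_ ?_
  · refine (measure_mono ?_).trans (hsm.trans (le_of_eq ?_))
    · intro ω hω
      refine ⟨hω, ?_⟩
      have hj : (jamCount (history (twoPhaseAlgorithm c) E ω (2 * (T + 2 * L))) : ℝ) ≤ d := by
        exact_mod_cast jamCount_history_le ω _
      rw [length_history]
      have : 2 * (T + 2 * L) / 2 = T + 2 * L := by omega
      rw [this]
      push_cast
      gcongr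
    · ring_nf
  · intro h hlen1 hlen2 hh
    obtain ⟨hact, h', hsuf, hl', hN', x, hst'⟩ := hh
    have hst := gstate_of_suffix hsuf (by rw [hl']; simp) hst'
    have hv' := gstate_valid h'
    rw [hst', hl'] at hv'
    obtain ⟨hx1, hx2⟩ := hv'
    have hNG : (numActive h : ℝ) ≤ G :=
      le_trans (by exact_mod_cast numActive_le_of_suffix hsuf) hN'
    set y := x + (h.length / 2 - h'.length / 2) with hy
    obtain ⟨hp1, hp2, hp3⟩ := hp y (by omega) (by omega)
    have hp0 : 0 ≤ c * Real.log y / y := by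
      have := Real.log_natCast_nonneg y
      positivity
    set p := c * Real.log y / y with hpdef
    set φ : ℝ := q * ((h.length / 2 : ℕ) - jamCount h) with hφ
    have hjle : ∀ s : Slot n, (jamCount h : ℝ) ≤ jamCount (s :: h) := fun s => by
      rw [jamCount_cons]; push_cast; split_ifs <;> simp
    rcases Nat.even_or_odd h.length with he | ho
    · have hk : ∀ s : Slot n, (s :: h).length / 2 = h.length / 2 := fun s => by
        obtain ⟨k, hk⟩ := he
        simp only [List.length_cons]
        omega
      refine stepInt_le_of_forall fun s => ?_
      split_ifs
      · rw [hk]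
        refine ENNReal.ofReal_le_ofReal (Real.exp_le_exp.2 ?_)
        exact mul_le_mul_of_nonneg_left (by linarith [hjle s]) hq
      · exact zero_le
    · have hk : ∀ s : Slot n, (s :: h).length / 2 = h.length / 2 + 1 := fun s => by
        obtain ⟨k, hk⟩ := ho
        simp only [List.length_cons]
        omega
      -- If `i` broadcasts alone it is no longer active, so the restricted exponential is `0` there.
      refine stepInt_le h {{i}} le_rfl (y := Real.exp (φ + q)) (q := q) (Real.exp_pos _).le
        ?_ ?_ ?_ ?_ ?_
      · intro R
        split_ifs
        · rw [hk, jamCount_cons]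
          refine ENNReal.ofReal_le_ofReal (Real.exp_le_exp.2 ?_)
          refine mul_le_mul_of_nonneg_left ?_ hq
          push_cast
          simp
        · exact zero_le
      · intro R hR
        rw [Set.mem_singleton_iff.1 hR, if_neg]
        · exact zero_le
        · rintro ⟨h1, -⟩
          exact not_isActive_cons_singleton h i h1
      · intro R
        split_ifs
        · rw [hk]
          refine ENNReal.ofReal_le_ofReal (Real.exp_le_exp.2 ?_)
          have := mul_le_mul_of_nonneg_left (hjle ⟨R, false⟩) hq
          rw [hφ]
          push_cast
          linarith
        · exact zero_le
      · have hpr : bcastProb c h = p := by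
          rw [bcastProb, if_neg (Nat.not_even_iff_odd.2 ho), hst, State.controlProb, min_eq_left]
          linarith
        simp only [Set.mem_singleton_iff]
        rw [volume_sendersOf_eq_singleton (sendProb_view hc h) (mem_activeSet.2 hact)]
        simp only
        rw [hpr]
        refine ENNReal.ofReal_le_ofReal (hp3.trans ?_)
        gcongr
        refine le_trans (Real.exp_le_exp.2 ?_) (exp_le_one_sub_pow hp0 hp1 _)
        have := mul_le_mul_of_nonneg_left hNG hp0
        linarith
      · rw [Real.exp_add, mul_zero, zero_add]
        have h1 : 1 - q ≤ Real.exp (-q) := by linarith [Real.add_one_le_exp (-q)]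
        calc (1 - q) * (Real.exp φ * Real.exp q) ≤ Real.exp (-q) * (Real.exp φ * Real.exp q) := by
              gcongr
          _ = Real.exp φ := by rw [← Real.exp_add, ← Real.exp_add]; ring_nf
  · intro h hlen _
    have : h.length / 2 = T + L := by omega
    rw [this]
    push_cast
    refine mul_le_mul_of_nonneg_left ?_ hq
    linarith [Nat.cast_nonneg (α := ℝ) (jamCount h)]

theorem history_suffix {A : Algorithm} {E : Adversary n d} (ω : Coins n) {s t : ℕ} (hst : s ≤ t) :
    history A E ω s <:+ history A E ω t := by
  induction t, hst using Nat.le_induction with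
  | base => exact List.suffix_refl _
  | succ t _ ih => exact ih.trans (List.suffix_cons _ _)

theorem exists_isActive_subset {c g G : ℝ} {T t : ℕ} (ht : 2 * T ≤ t) (E : Adversary n d) :
    {ω | ∃ i, IsActive (history (twoPhaseAlgorithm c) E ω t) i} ⊆
      ({ω | ¬ Controlled g G (history (twoPhaseAlgorithm c) E ω (2 * T))} ∪
        {ω | InPhaseOne g G (history (twoPhaseAlgorithm c) E ω (2 * T))}) ∪
        ⋃ i, {ω | WaitsInPhaseTwo T G i (history (twoPhaseAlgorithm c) E ω t)} := by
  rintro ω ⟨i, hi⟩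
  by_cases h1 : Controlled g G (history (twoPhaseAlgorithm c) E ω (2 * T))
  · by_cases h2 : InPhaseOne g G (history (twoPhaseAlgorithm c) E ω (2 * T))
    · exact Or.inl (Or.inr h2)
    · refine Or.inr (Set.mem_iUnion.2 ⟨i, hi, _, history_suffix ω ht, length_history _ _, ?_⟩)
      have h3 : 1 ≤ numActive (history (twoPhaseAlgorithm c) E ω (2 * T)) :=
        numActive_pos_iff.2 ⟨i, isActive_history_mono ht hi⟩
      have h4 := h1.inv
      match hst : gstate (history (twoPhaseAlgorithm c) E ω (2 * T)) with
      | .one l t m => exact absurd ⟨h1, h3, by rw [hst]; trivial⟩ h2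
      | .two x =>
        rw [hst] at h4
        exact ⟨h4, x, rfl⟩
  · exact Or.inl (Or.inl h1)

/-! ### Choice of the constants -/

theorem log_le_sqrt {x : ℝ} (hx : 0 < x) : Real.log x ≤ √x := by
  have h1 := log_le_half (Real.sqrt_pos.2 hx)
  rw [Real.log_sqrt hx.le] at h1
  linarith

theorem exists_mul_log_le_sqrt {a : ℝ} (ha : 0 < a) :
    ∃ l₀ : ℝ, 4 ≤ l₀ ∧ ∀ l, l₀ ≤ l → a * Real.log l ≤ √l := by
  have h1 := (isLittleO_log_rpow_atTop (r := 1 / 2) (by norm_num)).bound (inv_pos.2 ha)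
  obtain ⟨l₀, hl₀⟩ := Filter.eventually_atTop.1 h1
  refine ⟨max 4 l₀, le_max_left _ _, fun l hl => ?_⟩
  have h2 := hl₀ l ((le_max_right _ _).trans hl)
  have h4 : 4 ≤ l := (le_max_left _ _).trans hl
  rw [← Real.sqrt_eq_rpow, Real.norm_of_nonneg (Real.sqrt_nonneg _)] at h2
  calc a * Real.log l ≤ a * (a⁻¹ * √l) := by
        gcongr
        exact (le_abs_self _).trans h2
    _ = √l := by field_simp

/-! ### Drift inequalities for the potential of phase one -/

theorem exp_mul_one_sub_le {x : ℝ} : Real.exp x * (1 - x) ≤ 1 := by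
  calc Real.exp x * (1 - x) ≤ Real.exp x * Real.exp (-x) := by
        gcongr
        linarith [Real.add_one_le_exp (-x)]
    _ = 1 := by rw [← Real.exp_add]; simp

/-- The mean drop is `δ * b = 4`; for `lam * b ≤ 1` linearizing the exponential loses at most half
of it, which still covers `2`. -/
theorem data_drift {δ b lam : ℝ} (hδ : 0 ≤ δ) (hb : δ * b = 4) (hlam : 0 ≤ lam * b)
    (hlamb : lam * b ≤ 1) :
    δ * Real.exp (lam * (2 - b)) + (1 - δ) * Real.exp (lam * 2) ≤ 1 := by
  have h1 : Real.exp (-(lam * b)) ≤ 1 - lam * b / 2 := by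
    have := exp_neg_le_one_sub (x := lam * b / 2) (by linarith) (by linarith)
    rwa [show 2 * (lam * b / 2) = lam * b by ring] at this
  have h2 : Real.exp (lam * (2 - b)) = Real.exp (lam * 2) * Real.exp (-(lam * b)) := by
    rw [← Real.exp_add]; ring_nf
  have h3 := exp_mul_one_sub_le (x := lam * 2)
  have h4 : δ * Real.exp (-(lam * b)) + (1 - δ) ≤ 1 - lam * 2 := by
    have h5 := mul_le_mul_of_nonneg_left h1 hδ
    have h6 : δ * (1 - lam * b / 2) = δ - 2 * lam := by linear_combination -(lam / 2) * hb
    linarith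
  rw [h2]
  nlinarith [Real.exp_pos (lam * 2)]

/-- Here `lam * l` need not be small, so the exponential cannot be linearized. The bound `exp (-z) ≤
1 / (1 + z)` is used instead, and `1 + z` appears in the hypothesis. -/
theorem control_drift {q l lam : ℝ} (hq : 0 ≤ q) (hlam : 0 ≤ lam) (hl : 0 ≤ l)
    (h : 2 * (1 + lam * (1 + l / 2)) ≤ q * (1 + l / 2)) :
    q * Real.exp (lam * (1 - l / 2)) + (1 - q) * Real.exp (lam * 2) ≤ 1 := by
  set z := lam * (1 + l / 2) with hz
  have hz0 : 0 ≤ z := by positivity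
  have h1 : Real.exp (-z) ≤ 1 - z / (1 + z) := by
    have h2 : 1 - z / (1 + z) = (1 + z)⁻¹ := by field_simp; ring
    rw [h2, Real.exp_neg]
    exact inv_anti₀ (by linarith) (by linarith [Real.add_one_le_exp z])
  have h2 : Real.exp (lam * (1 - l / 2)) = Real.exp (lam * 2) * Real.exp (-z) := by
    rw [← Real.exp_add, hz]; ring_nf
  have h3 := exp_mul_one_sub_le (x := lam * 2)
  have h5 : lam * 2 ≤ q * (z / (1 + z)) := by
    rw [mul_div_assoc', le_div_iff₀ (by linarith), hz]
    nlinarith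
  have h4 : q * Real.exp (-z) + (1 - q) ≤ 1 - lam * 2 := by
    nlinarith [mul_le_mul_of_nonneg_left h1 hq]
  rw [h2]
  nlinarith [Real.exp_pos (lam * 2)]

/-- For `t ≥ √M` the logarithms of `t` and `M` are comparable; for smaller `t` the quotient is at
most `2 * √M`, which is of lower order. -/
theorem two_mul_div_log_le {K M t : ℕ} (hK : 1 ≤ K) (hM : 16 ≤ M) (ht : 2 ≤ t)
    (htT : t ≤ K * M + 1) :
    2 * ((t : ℝ) / Real.log t) ≤ 8 * K * M / Real.log M := by
  have hM' : (16:ℝ) ≤ M := by exact_mod_cast hM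
  have hK' : (1:ℝ) ≤ K := by exact_mod_cast hK
  have ht' : (2:ℝ) ≤ t := by exact_mod_cast ht
  have htT' : (t:ℝ) ≤ K * M + 1 := by exact_mod_cast htT
  have hlM : 0 < Real.log M := Real.log_pos (by linarith)
  have hlt : 0 < Real.log t := Real.log_pos (by linarith)
  have hKM : (1:ℝ) ≤ K * M := by nlinarith
  rcases le_total (√(M:ℝ)) t with h1 | h1
  · have h2 : Real.log M / 2 ≤ Real.log t := by
      rw [← Real.log_sqrt (by linarith)]
      exact Real.log_le_log (Real.sqrt_pos.2 (by linarith)) h1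
    rw [mul_div_assoc', div_le_div_iff₀ hlt hlM]
    calc 2 * (t:ℝ) * Real.log M ≤ 2 * (2 * (K * M)) * Real.log M := by gcongr; linarith
      _ = 8 * K * M * (Real.log M / 2) := by ring
      _ ≤ 8 * K * M * Real.log t := by gcongr
  · have h2 : 1 / 2 ≤ Real.log t :=
      le_trans (by linarith [Real.log_two_gt_d9]) (Real.log_le_log (by norm_num) ht')
    have h3 := log_le_sqrt (x := M) (by linarith)
    have h4 : √(M:ℝ) * √M = M := Real.mul_self_sqrt (by linarith)
    have h5 : (t:ℝ) / Real.log t ≤ 2 * √M := by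
      rw [div_le_iff₀ hlt]
      nlinarith
    rw [le_div_iff₀ hlM]
    calc 2 * ((t:ℝ) / Real.log t) * Real.log M ≤ 2 * (2 * √M) * √M := by gcongr
      _ = 4 * (√M * √M) := by ring
      _ = 4 * 1 * M := by rw [h4]; ring
      _ ≤ 8 * K * M := by gcongr; norm_num

/-- With high probability no node is active after `O(M)` slots, where `M` bounds the number of
nodes and the jamming budget. -/
theorem exists_measure_exists_isActive_le {γ : ℝ} (hγ : 1 ≤ γ) :
    ∃ c : ℝ, 0 < c ∧ ∃ B M₀ : ℕ, ∀ M : ℕ, M₀ ≤ M → ∀ n d : ℕ, n ≤ M → d ≤ M →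
      ∀ E : Adversary n d,
        coinMeasure n {ω | ∃ i, IsActive (history (twoPhaseAlgorithm c) E ω (B * M)) i} ≤
          ENNReal.ofReal (3 * Real.exp (-(γ * Real.log M))) := by
  -- The factor `exp 2` cancels the loss `exp (-2)` from the silence of the other nodes.
  obtain ⟨c, hc⟩ : ∃ c : ℝ, c = 64 * Real.exp 2 * γ := ⟨_, rfl⟩
  have he2 : 1 ≤ Real.exp 2 := Real.one_le_exp (by norm_num)
  have hcγ : 64 * γ ≤ c := by
    rw [hc, mul_right_comm]
    exact le_mul_of_one_le_right (by linarith) he2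
  have hc0 : 0 < c := by linarith
  have hce : c * Real.exp (-2) = 64 * γ := by
    have : Real.exp 2 * Real.exp (-2) = 1 := by rw [← Real.exp_add]; simp
    rw [hc]; linear_combination 64 * γ * this
  obtain ⟨A, hA⟩ : ∃ A : ℝ, A = 4 * c := ⟨_, rfl⟩
  obtain ⟨δ, hδ⟩ : ∃ δ : ℝ, δ = Real.exp (-4) / A := ⟨_, rfl⟩
  have hA0 : 0 < A := by linarith
  have hδ0 : 0 < δ := by rw [hδ]; positivity
  obtain ⟨b, hb⟩ : ∃ b : ℝ, b = 4 / δ := ⟨_, rfl⟩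
  have hδb : δ * b = 4 := by rw [hb]; field_simp
  have hb0 : 0 < b := by rw [hb]; positivity
  -- Half of the `K * M` rounds then covers the initial potential and the jams, `2 * M + 1 + b * M +
  -- 2 * d`.
  obtain ⟨K, hK⟩ := exists_nat_ge (2 * (b + 5))
  have hK1' : (10:ℝ) ≤ K := by linarith
  have hK1 : 1 ≤ K := by
    have : (1:ℝ) ≤ K := by linarith
    exact_mod_cast this
  -- Once `x ≥ K' * M`, the load `p * G` in phase two is at most `16 * c * K / K'`.
  obtain ⟨K', hK'⟩ := exists_nat_ge (16 * c * K)
  have hKK' : K ≤ K' := by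
    have : (K:ℝ) ≤ K' := (le_mul_of_one_le_left (by linarith) (by linarith)).trans hK'
    exact_mod_cast this
  have hK'2 : (2:ℝ) ≤ K' := by
    have : (K:ℝ) ≤ K' := by exact_mod_cast hKK'
    linarith
  obtain ⟨l₀, hl₀4, hl₀⟩ := exists_mul_log_le_sqrt hc0
  obtain ⟨R, hR⟩ := exists_nat_ge (l₀ ^ 2)
  refine ⟨c, hc0, 2 * (K + 2 * K'), max 16 (max (2 * K) (max K' R)), ?_⟩
  intro M hM n d hn hd E
  simp only [max_le_iff] at hM
  obtain ⟨hM16, hM2K, hMK', hMR⟩ := hM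
  have hM16' : (16:ℝ) ≤ M := by exact_mod_cast hM16
  have hM2K' : (2:ℝ) * K ≤ M := by exact_mod_cast hM2K
  have hMK'' : (K':ℝ) ≤ M := by exact_mod_cast hMK'
  have hMR' : (R:ℝ) ≤ M := by exact_mod_cast hMR
  have hn' : (n:ℝ) ≤ M := by exact_mod_cast hn
  have hd' : (d:ℝ) ≤ M := by exact_mod_cast hd
  have hM0 : (0:ℝ) < M := by linarith
  have hlogM : 1 ≤ Real.log M := by
    rw [Real.le_log_iff_exp_le hM0]
    linarith [Real.exp_one_lt_d9]
  obtain ⟨g, hg⟩ : ∃ g : ℝ, g = √(M:ℝ) := ⟨_, rfl⟩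
  have hgg : g * g = M := by rw [hg]; exact Real.mul_self_sqrt hM0.le
  have hg4 : 4 ≤ g := by rw [hg]; exact Real.le_sqrt_of_sq_le (by norm_num; linarith)
  have hgM : g ≤ M := by
    rw [← hgg]
    exact le_mul_of_one_le_left (by linarith) (by linarith)
  have hgl₀ : l₀ ≤ g := by rw [hg]; exact Real.le_sqrt_of_sq_le (by linarith)
  have hlogg : Real.log g = Real.log M / 2 := by rw [hg]; exact Real.log_sqrt hM0.le
  obtain ⟨G, hG⟩ : ∃ G : ℝ, G = 8 * K * M / Real.log M := ⟨_, rfl⟩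
  have hG2 : ∀ t : ℕ, 2 ≤ t → t ≤ K * M + 1 → 2 * ((t : ℝ) / Real.log t) ≤ G :=
    fun t h1 h2 => by rw [hG]; exact two_mul_div_log_le hK1 hM16 h1 h2
  have hgG : g ≤ G := by
    rw [hG, le_div_iff₀ (by linarith)]
    calc g * Real.log M ≤ g * g := by
          gcongr
          rw [hg]
          exact log_le_sqrt hM0
      _ = 1 * M := by rw [hgg, one_mul]
      _ ≤ 8 * K * M := by gcongr; linarith
  have hpc : ∀ l, g ≤ l → c * Real.log l / l ≤ 1 / 2 := by
    intro l hl
    have h1 := hl₀ l (hgl₀.trans hl)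
    have hl0 : 0 < l := by linarith
    have h2 : √l * √l = l := Real.mul_self_sqrt hl0.le
    have h3 : 2 ≤ √l := Real.le_sqrt_of_sq_le (by linarith)
    rw [div_le_iff₀ hl0]
    nlinarith only [h1, h2, h3]
  have hlarge : ∀ l, g ≤ l →
      c * Real.exp (-2) * Real.log l / l ≤ Real.exp (-(Real.log l / 2)) := by
    intro l hl
    have h1 := hl₀ l (hgl₀.trans hl)
    have hl0 : 0 < l := by linarith
    have h2 : √l * √l = l := Real.mul_self_sqrt hl0.le
    have h3 : 0 < √l := Real.sqrt_pos.2 hl0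
    have h4 : 0 ≤ Real.log l := Real.log_nonneg (by linarith)
    rw [← Real.log_sqrt hl0.le, ← Real.log_inv, Real.exp_log (inv_pos.2 h3), hce, div_le_iff₀ hl0]
    have h5 : (√l)⁻¹ * l = √l := by field_simp; linarith
    rw [h5]
    exact (mul_le_mul_of_nonneg_right hcγ h4).trans h1
  -- Chosen so that a deficit of `K * M / 2` in the potential costs exactly `γ * log M` in the
  -- exponent.
  obtain ⟨lam, hlam⟩ : ∃ lam : ℝ, lam = 2 * γ * Real.log M / (K * M) := ⟨_, rfl⟩
  have hlam0 : 0 < lam := by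
    have : 0 < Real.log M := by linarith
    have : (0:ℝ) < K := by linarith
    rw [hlam]
    positivity
  have hlamKM : lam * (K * M) = 2 * γ * Real.log M := by
    rw [hlam]
    have : (0:ℝ) < K := by linarith
    field_simp
  have hlamb : lam * b ≤ 1 := by
    have h1 := hpc M hgM
    rw [div_le_iff₀ hM0] at h1
    have h2 : 2 * b ≤ K := by linarith
    rw [hlam, div_mul_eq_mul_div, div_le_one (by positivity)]
    have h3 : 0 ≤ γ * Real.log M := by positivity
    calc 2 * γ * Real.log M * b = γ * Real.log M * (2 * b) := by ring
      _ ≤ γ * Real.log M * K := by gcongr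
      _ ≤ M * K := by
        gcongr
        calc γ * Real.log M ≤ c * Real.log M := by gcongr; linarith
          _ ≤ M := by linarith
      _ = K * M := by ring
  have hdata := data_drift hδ0.le hδb (by positivity) hlamb
  rw [hδ] at hdata
  have hKM1 : (1:ℝ) ≤ K * M := one_le_mul_of_one_le_of_one_le (by linarith) (by linarith)
  have hcontrol : ∀ l, g ≤ l → l ≤ ((K * M : ℕ) : ℝ) + 1 →
      c * Real.exp (-2) * Real.log l / l * Real.exp (lam * (1 - l / 2)) +
        (1 - c * Real.exp (-2) * Real.log l / l) * Real.exp (lam * 2) ≤ 1 := by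
    intro l hl hlT
    push_cast at hlT
    have hl0 : 0 < l := by linarith
    have hlogl : Real.log M / 2 ≤ Real.log l := by
      rw [← hlogg]
      exact Real.log_le_log (by linarith) hl
    rw [hce]
    have hlogl0 : 0 ≤ Real.log l := by linarith
    refine control_drift (by positivity) hlam0.le hl0.le ?_
    have h1 : lam * (1 + l / 2) ≤ 4 * γ * Real.log M := by
      calc lam * (1 + l / 2) ≤ lam * (2 * (K * M)) := by gcongr; linarith
        _ = 2 * (lam * (K * M)) := by ring
        _ = _ := by rw [hlamKM]; ring
    have h2 : 32 * γ * Real.log l ≤ 64 * γ * Real.log l / l * (1 + l / 2) := by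
      have h3 : 64 * γ * Real.log l / l * (1 + l / 2) =
          64 * γ * Real.log l / l + 32 * γ * Real.log l := by field_simp; ring
      rw [h3]
      have : 0 ≤ 64 * γ * Real.log l / l := by positivity
      linarith
    have h4 : 1 ≤ γ * Real.log M := one_le_mul_of_one_le_of_one_le hγ hlogM
    have h5 : γ * (Real.log M / 2) ≤ γ * Real.log l := by gcongr
    linarith
  have hone := measure_inPhaseOne_le (G := G) (M := M) (T := K * M) (A := A) (b := b) hc0 hA.ge
    hb0.le hlam0 hg4 hn (Nat.le_mul_of_pos_left M hK1) hgM
    (fun t ht => by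
      have ht' : (M:ℝ) ≤ t := by exact_mod_cast ht
      have ht0 : (0:ℝ) < t := by linarith
      have h1 := log_le_sqrt ht0
      have h2 : g ≤ √(t:ℝ) := by rw [hg]; exact Real.sqrt_le_sqrt ht'
      have h3 : √(t:ℝ) * √t = t := Real.mul_self_sqrt ht0.le
      rw [le_div_iff₀ (Real.log_pos (by linarith))]
      have : 0 ≤ Real.log (t:ℝ) := Real.log_nonneg (by linarith)
      calc g * Real.log t ≤ √t * √t := by gcongr
        _ = t := h3)
    hpc hlarge hdata hcontrol E
  have hctrl := measure_not_controlled_le (c := c) (by linarith) hg4 hgG (K * M) hG2 E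
  have hLM : (M:ℝ) ≤ K' * M := le_mul_of_one_le_left hM0.le (by linarith)
  have hwait : ∀ i, coinMeasure n {ω | WaitsInPhaseTwo (K * M) G i
      (history (twoPhaseAlgorithm c) E ω (2 * (K * M + 2 * (K' * M))))} ≤
        ENNReal.ofReal (Real.exp (16 * γ * Real.log M / (K' * M) * (d - (K' * M : ℕ)))) := by
    refine measure_waitsInPhaseTwo_le hc0.le (by positivity) ?_ E
    intro x hx1 hx2
    have hx1' : (K':ℝ) * M ≤ x := by exact_mod_cast hx1
    have hx2' : (x:ℝ) ≤ K * M + 2 * (K' * M) := by exact_mod_cast hx2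
    have hKK'' : (K:ℝ) ≤ K' := by exact_mod_cast hKK'
    have hx3 : (x:ℝ) ≤ 3 * (K' * M) := by
      have : (K:ℝ) * M ≤ K' * M := by gcongr
      linarith
    have hMx : (M:ℝ) ≤ x := hLM.trans hx1'
    have hx0 : (0:ℝ) < x := by linarith
    have hK'0 : (0:ℝ) < K' := by linarith
    have hKM0 : (0:ℝ) < K' * M := by positivity
    have hlM0 : 0 < Real.log M := by linarith
    refine ⟨hpc x (hgM.trans hMx), ?_, ?_⟩
    · have he : Real.exp 1 ≤ K' * M := by linarith [Real.exp_one_lt_d9]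
      have h1 := Real.log_div_self_antitoneOn (Set.mem_Ici.2 he) (Set.mem_Ici.2 (he.trans hx1'))
        hx1'
      simp only at h1
      have h2 : Real.log (K' * M) ≤ 2 * Real.log M := by
        rw [Real.log_mul hK'0.ne' hM0.ne']
        have := Real.log_le_log hK'0 hMK''
        linarith
      calc c * Real.log x / x * G = c * (Real.log x / x) * G := by ring
        _ ≤ c * (2 * Real.log M / (K' * M)) * G := by
          have : 0 ≤ G := by linarith
          refine mul_le_mul_of_nonneg_right (mul_le_mul_of_nonneg_left (h1.trans ?_) hc0.le) this
          exact div_le_div_of_nonneg_right h2 hKM0.le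
        _ = 16 * c * K / K' := by rw [hG]; field_simp; ring
        _ ≤ 1 := div_le_one_of_le₀ hK' hK'0.le
    · have h1 : Real.log M ≤ Real.log x := Real.log_le_log hM0 hMx
      calc 16 * γ * Real.log M / (K' * M) ≤ 64 * γ * Real.log M / (3 * (K' * M)) := by
            rw [div_le_div_iff₀ hKM0 (by positivity)]
            have : 0 ≤ γ * Real.log M * (K' * M) := by positivity
            linarith
        _ ≤ 64 * γ * Real.log x / x := by gcongr
        _ = c * Real.log x / x * Real.exp (-2) := by rw [← hce]; ring
  have hBM : 2 * (K + 2 * K') * M = 2 * (K * M + 2 * (K' * M)) := by ring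
  rw [hBM]
  refine (measure_mono (exists_isActive_subset (g := g) (G := G) (T := K * M) (by omega) E)).trans ?_
  have e1 : ((2 * (K * M) : ℕ) : ℝ) * Real.exp (-((c / 4 - 1) * Real.log g)) ≤
      Real.exp (-(γ * Real.log M)) := by
    calc ((2 * (K * M) : ℕ) : ℝ) * Real.exp (-((c / 4 - 1) * Real.log g))
        ≤ (M * M) * Real.exp (-((c / 4 - 1) * Real.log g)) := by
          gcongr
          push_cast
          calc 2 * ((K:ℝ) * M) = 2 * K * M := by ring
            _ ≤ M * M := by gcongr
      _ = Real.exp (Real.log M + Real.log M + -((c / 4 - 1) * Real.log g)) := by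
          rw [Real.exp_add, Real.exp_add, Real.exp_log hM0]
      _ ≤ _ := by
          refine Real.exp_le_exp.2 ?_
          rw [hlogg]
          have h1 : 64 * γ * Real.log M ≤ c * Real.log M := by gcongr
          have h2 : Real.log M ≤ γ * Real.log M := le_mul_of_one_le_left (by linarith) hγ
          linarith
  have e2 : Real.exp (lam * (2 * M + 1 + b * M + 2 * d - ((K * M : ℕ) : ℝ))) ≤
      Real.exp (-(γ * Real.log M)) := by
    refine Real.exp_le_exp.2 ?_
    push_cast
    calc lam * (2 * M + 1 + b * M + 2 * d - K * M) ≤ lam * (-(K * M / 2)) := by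
          refine mul_le_mul_of_nonneg_left ?_ hlam0.le
          have : 2 * (b + 5) * M ≤ K * M := by gcongr
          linarith
      _ = -(lam * (K * M) / 2) := by ring
      _ = _ := by rw [hlamKM]; ring
  -- `K' ≥ 2` leaves at least half of the rounds unjammed, so each node fails with probability at
  -- most `M ^ (-8 * γ)`, enough for the union over `n ≤ M` nodes.
  have e3 : (n:ℝ) * Real.exp (16 * γ * Real.log M / (K' * M) * (d - (K' * M : ℕ))) ≤
      Real.exp (-(γ * Real.log M)) := by
    have hK'0 : (0:ℝ) < K' := by linarith
    calc (n:ℝ) * Real.exp (16 * γ * Real.log M / (K' * M) * (d - (K' * M : ℕ)))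
        ≤ M * Real.exp (16 * γ * Real.log M / (K' * M) * (-(K' * M / 2))) := by
          have : (0:ℝ) ≤ 16 * γ * Real.log M / (K' * M) := by positivity
          gcongr
          push_cast
          have : 2 * (M:ℝ) ≤ K' * M := by gcongr
          linarith
      _ = Real.exp (Real.log M + -(8 * γ * Real.log M)) := by
          rw [Real.exp_add, Real.exp_log hM0]
          congr 2
          field_simp
          ring
      _ ≤ _ := by
          refine Real.exp_le_exp.2 ?_
          have h2 : Real.log M ≤ γ * Real.log M := le_mul_of_one_le_left (by linarith) hγ
          linarith
  calc _ ≤ (coinMeasure n {ω | ¬ Controlled g G (history (twoPhaseAlgorithm c) E ω (2 * (K * M)))} +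
          coinMeasure n {ω | InPhaseOne g G (history (twoPhaseAlgorithm c) E ω (2 * (K * M)))}) +
          ∑ i, coinMeasure n {ω | WaitsInPhaseTwo (K * M) G i
            (history (twoPhaseAlgorithm c) E ω (2 * (K * M + 2 * (K' * M))))} := by
        refine (measure_union_le _ _).trans (add_le_add (measure_union_le _ _) ?_)
        exact measure_iUnion_fintype_le _ _
    _ ≤ (ENNReal.ofReal (Real.exp (-(γ * Real.log M))) +
          ENNReal.ofReal (Real.exp (-(γ * Real.log M)))) +
          ENNReal.ofReal (Real.exp (-(γ * Real.log M))) := by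
        refine add_le_add (add_le_add (hctrl.trans (ENNReal.ofReal_le_ofReal e1))
          (hone.trans (ENNReal.ofReal_le_ofReal e2))) ?_
        refine (Finset.sum_le_sum fun i _ => hwait i).trans ?_
        rw [Finset.sum_const, Finset.card_univ, Fintype.card_fin, nsmul_eq_mul,
          ← ENNReal.ofReal_natCast, ← ENNReal.ofReal_mul (Nat.cast_nonneg _)]
        exact ENNReal.ofReal_le_ofReal e3
    _ = _ := by
        rw [← ENNReal.ofReal_add (by positivity) (by positivity),
          ← ENNReal.ofReal_add (by positivity) (by positivity)]
        ring_nf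

/-! ### The two costs -/

theorem one_sub_le_measureReal {α : Type*} [MeasurableSpace α] {μ : Measure α}
    [IsProbabilityMeasure μ] {S : Set α} {ε : ℝ} (hε : 0 ≤ ε) (h : μ Sᶜ ≤ ENNReal.ofReal ε) :
    1 - ε ≤ μ.real S := by
  have h1 : μ.real Sᶜ ≤ ε := ENNReal.toReal_le_of_le_ofReal hε h
  have h2 : μ.real (S ∪ Sᶜ) ≤ μ.real S + μ.real Sᶜ := measureReal_union_le _ _
  rw [Set.union_compl_self, probReal_univ] at h2
  linarith

/-- The surplus `4` in the exponent absorbs the number of failure events: three for termination and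
one for energy. -/
theorem four_mul_exp_le {β x M : ℝ} (hβ : 0 ≤ β) (hx : 0 < x) (hxM : x ≤ M) (hM : 16 ≤ M) :
    4 * Real.exp (-((β + 4) * Real.log M)) ≤ 1 / x ^ β := by
  have hlogM : 1 ≤ Real.log M := by
    rw [Real.le_log_iff_exp_le (by linarith)]
    linarith [Real.exp_one_lt_d9]
  have h4 : (4:ℝ) ≤ Real.exp (4 * Real.log M) := by
    linarith [Real.add_one_le_exp (4 * Real.log M)]
  calc 4 * Real.exp (-((β + 4) * Real.log M))
      ≤ Real.exp (4 * Real.log M) * Real.exp (-((β + 4) * Real.log M)) := by gcongr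
    _ = Real.exp (-(β * Real.log M)) := by rw [← Real.exp_add]; ring_nf
    _ ≤ Real.exp (-(β * Real.log x)) := by gcongr
    _ = 1 / x ^ β := by
      rw [Real.rpow_def_of_pos hx, Real.exp_neg, one_div, mul_comm]

theorem encard_le_ofReal {S : Set ℕ} {F : Finset ℕ} {r : ℝ} (hS : S ⊆ F) (hF : (F.card : ℝ) ≤ r) :
    (S.encard : ENNReal) ≤ ENNReal.ofReal r := by
  have h1 : S.encard ≤ F.card := by
    rw [← Set.encard_coe_eq_coe_finsetCard]
    exact Set.encard_le_encard hS
  calc (S.encard : ENNReal) ≤ ((F.card : ℕ∞) : ENNReal) := by exact_mod_cast h1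
    _ = ENNReal.ofReal F.card := by simp
    _ ≤ ENNReal.ofReal r := ENNReal.ofReal_le_ofReal hF

/-- The constant `k`, which makes `M = n + d + k` large enough, is absorbed through `log (n + 1) ≥
log 2`. -/
theorem log_add_sq_le {n d k : ℕ} (hn : 1 ≤ n) :
    Real.log (n + d + k : ℕ) ^ 2 ≤ 2 * (1 + Real.log (k + 1) / Real.log 2) ^ 2 *
      (Real.log (n + 1) ^ 2 + Real.log (d + 1) ^ 2) := by
  have hn' : (1:ℝ) ≤ n := by exact_mod_cast hn
  have hd' : (0:ℝ) ≤ d := Nat.cast_nonneg d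
  have hk' : (0:ℝ) ≤ k := Nat.cast_nonneg k
  have hl2 : 0 < Real.log 2 := Real.log_pos (by norm_num)
  have ha : Real.log 2 ≤ Real.log (n + 1) := Real.log_le_log (by norm_num) (by linarith)
  have hb : 0 ≤ Real.log ((d:ℝ) + 1) := Real.log_nonneg (by linarith)
  have hk : 0 ≤ Real.log ((k:ℝ) + 1) := Real.log_nonneg (by linarith)
  set κ := Real.log ((k:ℝ) + 1) / Real.log 2 with hκ
  have hκ0 : 0 ≤ κ := by positivity
  have h1 : Real.log ((n + d + k : ℕ) : ℝ) ≤
      Real.log (n + 1) + Real.log (d + 1) + Real.log (k + 1) := by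
    rw [← Real.log_mul (by positivity) (by positivity),
      ← Real.log_mul (by positivity) (by positivity)]
    refine Real.log_le_log (by push_cast; linarith) ?_
    push_cast
    have e1 : 0 ≤ (n:ℝ) * d := by positivity
    have e2 : 0 ≤ (n:ℝ) * k := by positivity
    have e3 : 0 ≤ (d:ℝ) * k := by positivity
    have e4 : 0 ≤ (n:ℝ) * d * k := by positivity
    linarith
  have h2 : Real.log ((k:ℝ) + 1) = κ * Real.log 2 := by rw [hκ]; field_simp
  have h3 : Real.log ((n + d + k : ℕ) : ℝ) ≤ (1 + κ) * (Real.log (n + 1) + Real.log (d + 1)) := by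
    have h4 : κ * Real.log 2 ≤ κ * Real.log (n + 1) := by gcongr
    have h5 : 0 ≤ κ * Real.log ((d:ℝ) + 1) := by positivity
    linarith
  calc Real.log ((n + d + k : ℕ) : ℝ) ^ 2
      ≤ ((1 + κ) * (Real.log (n + 1) + Real.log (d + 1))) ^ 2 :=
        pow_le_pow_left₀ (Real.log_natCast_nonneg _) h3 2
    _ = (1 + κ) ^ 2 * (Real.log (n + 1) + Real.log (d + 1)) ^ 2 := by ring
    _ ≤ (1 + κ) ^ 2 * (2 * (Real.log (n + 1) ^ 2 + Real.log (d + 1) ^ 2)) := by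
        gcongr
        exact add_sq_le
    _ = _ := by ring

variable {c β : ℝ} {B M₀ : ℕ}

theorem achievesTimeCost_of_measure_le (hβ : 0 ≤ β)
    (h : ∀ M : ℕ, M₀ ≤ M → ∀ n d : ℕ, n ≤ M → d ≤ M → ∀ E : Adversary n d,
      coinMeasure n {ω | ∃ i, IsActive (history (twoPhaseAlgorithm c) E ω (B * M)) i} ≤
        ENNReal.ofReal (3 * Real.exp (-((β + 4) * Real.log M)))) :
    AchievesTimeCost (twoPhaseAlgorithm c) β (fun n => (n : ℝ)) (fun d => (d : ℝ)) := by
  refine ⟨B * (1 + max 16 M₀ : ℕ), fun n d hn hd E => ?_⟩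
  have hn' : (1:ℝ) ≤ n := by exact_mod_cast hn
  have hd' : (1:ℝ) ≤ d := by exact_mod_cast hd
  set k := max 16 M₀ with hk
  have hk16 : 16 ≤ k := le_max_left _ _
  have hk0 : M₀ ≤ k := le_max_right _ _
  have hk' : (16:ℝ) ≤ k := by exact_mod_cast hk16
  have hfail := four_mul_exp_le (x := n + d) (M := (n + d + k : ℕ)) hβ (by linarith)
    (by push_cast; linarith) (by push_cast; linarith)
  refine one_sub_le_measureReal (by positivity) (le_trans (measure_mono ?_)
    ((h (n + d + k) (by omega) n d (by omega) (by omega) E).trans (ENNReal.ofReal_le_ofReal ?_)))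
  · intro ω hω
    by_contra hact
    refine hω (encard_le_ofReal (activeSlots_subset fun i hi => hact ⟨i, hi⟩) ?_)
    rw [Finset.card_range]
    push_cast
    rw [mul_assoc]
    gcongr
    nlinarith
  · linarith [Real.exp_pos (-((β + 4) * Real.log ((n + d + k : ℕ) : ℝ)))]

theorem achievesEnergyCost_of_measure_le (hc : 0 ≤ c) (hβ : 0 ≤ β)
    (h : ∀ M : ℕ, M₀ ≤ M → ∀ n d : ℕ, n ≤ M → d ≤ M → ∀ E : Adversary n d,
      coinMeasure n {ω | ∃ i, IsActive (history (twoPhaseAlgorithm c) E ω (B * M)) i} ≤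
        ENNReal.ofReal (3 * Real.exp (-((β + 4) * Real.log M)))) :
    AchievesEnergyCost (twoPhaseAlgorithm c) β
      (fun n => Real.log ((n : ℝ) + 1) ^ 2) (fun d => Real.log ((d : ℝ) + 1) ^ 2) := by
  -- `k > B` gives `B * M + 1 ≤ M ^ 2`, so the logarithm of the time horizon is at most `2 * log M`.
  set k := max (max 16 M₀) (B + 1) with hk
  refine ⟨(2 * (1 + 2 * c) * 21 + (β + 5)) *
    (2 * (1 + Real.log (k + 1) / Real.log 2) ^ 2), fun n d hn hd E => ?_⟩
  have hn' : (1:ℝ) ≤ n := by exact_mod_cast hn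
  have hd' : (1:ℝ) ≤ d := by exact_mod_cast hd
  have hk16 : 16 ≤ k := (le_max_left _ _).trans (le_max_left _ _)
  have hk0 : M₀ ≤ k := (le_max_right _ _).trans (le_max_left _ _)
  have hkB : B + 1 ≤ k := le_max_right _ _
  have hk' : (16:ℝ) ≤ k := by exact_mod_cast hk16
  have hkB' : (B:ℝ) + 1 ≤ k := by exact_mod_cast hkB
  have hlogsq := log_add_sq_le (n := n) (d := d) (k := k) hn
  set M := n + d + k with hM
  have hMk : (k:ℝ) ≤ M := by rw [hM]; push_cast; linarith
  have hMn : (n:ℝ) ≤ M := by rw [hM]; push_cast; linarith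
  have hM0 : (0:ℝ) < M := by linarith
  have hlogM : 1 ≤ Real.log M := by
    rw [Real.le_log_iff_exp_le hM0]
    linarith [Real.exp_one_lt_d9]
  have hfail := four_mul_exp_le (x := n + d) (M := M) hβ (by linarith)
    (by rw [hM]; push_cast; linarith) (by linarith)
  -- The compensator of `measure_attemptCount_le` plus a margin; `β + 5` rather than `β + 4` pays
  -- for the union over at most `M` nodes.
  set b : ℝ := 2 * (1 + c * Real.log ((B * M : ℕ) + 1)) * (10 * Real.log ((B * M : ℕ) + 1) + 1) +
    (β + 5) * Real.log M with hb
  have hbC : b ≤ (2 * (1 + 2 * c) * 21 + (β + 5)) * Real.log M ^ 2 := by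
    have hlT : Real.log ((B * M : ℕ) + 1) ≤ 2 * Real.log M := by
      rw [← Real.log_rpow hM0]
      refine Real.log_le_log (by positivity) ?_
      push_cast
      rw [Real.rpow_two]
      nlinarith
    have hlT0 : 0 ≤ Real.log (((B * M : ℕ) : ℝ) + 1) :=
      Real.log_nonneg (by linarith [Nat.cast_nonneg (α := ℝ) (B * M)])
    have h1 : 1 + c * Real.log ((B * M : ℕ) + 1) ≤ (1 + 2 * c) * Real.log M := by
      have := mul_le_mul_of_nonneg_left hlT hc
      linarith
    have h2 : 10 * Real.log ((B * M : ℕ) + 1) + 1 ≤ 21 * Real.log M := by linarith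
    have h3 : (β + 5) * Real.log M ≤ (β + 5) * Real.log M ^ 2 := by
      gcongr
      nlinarith
    have h4 : (1 + c * Real.log ((B * M : ℕ) + 1)) * (10 * Real.log ((B * M : ℕ) + 1) + 1) ≤
        ((1 + 2 * c) * Real.log M) * (21 * Real.log M) := by gcongr
    rw [hb]
    linarith
  refine one_sub_le_measureReal (by positivity) ?_
  have hsub : {ω | ∀ i, ((attempts (twoPhaseAlgorithm c) E ω i).encard : ENNReal) ≤
      ENNReal.ofReal ((2 * (1 + 2 * c) * 21 + (β + 5)) *
        (2 * (1 + Real.log (k + 1) / Real.log 2) ^ 2) *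
          (Real.log ((n : ℝ) + 1) ^ 2 + Real.log ((d : ℝ) + 1) ^ 2))}ᶜ ⊆
      {ω | ∃ i, IsActive (history (twoPhaseAlgorithm c) E ω (B * M)) i} ∪
        ⋃ i, {ω | b ≤ attemptCount i (history (twoPhaseAlgorithm c) E ω (B * M))} := by
    intro ω hω
    by_contra hcon
    simp only [Set.mem_union, Set.mem_iUnion, Set.mem_ofPred_eq, not_or, not_exists, not_le] at hcon
    obtain ⟨h1, h2⟩ := hcon
    refine hω fun i => encard_le_ofReal (attempts_subset h1 i) ?_
    rw [← attemptCount_history]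
    refine (h2 i).le.trans (hbC.trans ?_)
    exact (mul_le_mul_of_nonneg_left hlogsq (by positivity)).trans_eq (by ring)
  calc _ ≤ coinMeasure n {ω | ∃ i, IsActive (history (twoPhaseAlgorithm c) E ω (B * M)) i} +
        ∑ i, coinMeasure n
          {ω | b ≤ attemptCount i (history (twoPhaseAlgorithm c) E ω (B * M))} :=
        (measure_mono hsub).trans ((measure_union_le _ _).trans
          (add_le_add le_rfl (measure_iUnion_fintype_le _ _)))
    _ ≤ ENNReal.ofReal (3 * Real.exp (-((β + 4) * Real.log M))) +
        ENNReal.ofReal (Real.exp (-((β + 4) * Real.log M))) := by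
        refine add_le_add (h M (by omega) n d (by omega) (by omega) E) ?_
        refine (Finset.sum_le_sum fun i _ => measure_attemptCount_le hc E i (B * M) b).trans ?_
        rw [Finset.sum_const, Finset.card_univ, Fintype.card_fin, nsmul_eq_mul,
          ← ENNReal.ofReal_natCast, ← ENNReal.ofReal_mul (Nat.cast_nonneg _)]
        refine ENNReal.ofReal_le_ofReal ?_
        calc (n:ℝ) * Real.exp (2 * (1 + c * Real.log ((B * M : ℕ) + 1)) *
              (10 * Real.log ((B * M : ℕ) + 1) + 1) - b)
            ≤ Real.exp (Real.log M) * Real.exp (-((β + 5) * Real.log M)) := by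
              rw [Real.exp_log hM0, hb, sub_add_cancel_left]
              gcongr
          _ = _ := by rw [← Real.exp_add]; ring_nf
    _ = ENNReal.ofReal (4 * Real.exp (-((β + 4) * Real.log M))) := by
        rw [← ENNReal.ofReal_add (by positivity) (by positivity)]
        ring_nf
    _ ≤ _ := ENNReal.ofReal_le_ofReal hfail

end ContentionResolution

end

/-- For every desired exponent `β ≥ 1` of the failure probability, the two-phase algorithm with a
suitable constant `c` has time cost `O(n + d)` and energy cost `O(log² n + log² d)`. -/
theorem theorem1p2 (β : ℝ) (hβ : 1 ≤ β) :
    ∃ c : ℝ, 0 < c ∧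
      ContentionResolution.AchievesTimeCost (ContentionResolution.twoPhaseAlgorithm c) β
        (fun n => (n : ℝ)) (fun d => (d : ℝ)) ∧
      ContentionResolution.AchievesEnergyCost (ContentionResolution.twoPhaseAlgorithm c) β
        (fun n => Real.log ((n : ℝ) + 1) ^ 2) (fun d => Real.log ((d : ℝ) + 1) ^ 2) := by
  obtain ⟨c, hc, B, M₀, h⟩ :=
    ContentionResolution.exists_measure_exists_isActive_le (γ := β + 4) (by linarith)
  exact ⟨c, hc, ContentionResolution.achievesTimeCost_of_measure_le (by linarith) h,
    ContentionResolution.achievesEnergyCost_of_measure_le hc.le (by linarith) h⟩
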